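/- Fix countably infinite, pairwise disjoint sets of concept names $A$, role names $r$ and individual names $a$. The terms and concepts of $\mathcal{ALCO}_u^{\iota}$ are given by $\tau ::= a \mid \iota C$ and $C ::= A \mid \{\tau\} \mid \lnot C \mid C\sqcap C \mid \exists r.C \mid \exists u.C$. An $\mathcal{ALCO}_u^{\iota}$ ontology is a finite set of axioms $C\sqsubseteq D$, $C(\tau)$, $r(\tau_1,\tau_2)$. A partial interpretation $\mathcal I$ consists of a non-empty domain $\Delta$, sets $A^{\mathcal I}\subseteq\Delta$, relations $r^{\mathcal I}\subseteq\Delta\times\Delta$, and a partial map $a\mapsto a^{\mathcal I}\in\Delta$. In $\mathcal I$, $\iota C$ denotes $d$ if $C^{\mathcal I}=\{d\}$ and is undefined if $C^{\mathcal I}$ is not a singleton; $\{\tau\}^{\mathcal I}$ is $\{\tau^{\mathcal I}\}$ if $\tau$ denotes and $\emptyset$ otherwise; $\lnot$, $\sqcap$, $\exists r$ are interpreted as usual and $u$ as $\Delta\times\Delta$. $C\sqsubseteq D$ holds iff $C^{\mathcal I}\subseteq D^{\mathcal I}$; the assertions $C(\tau)$ and $r(\tau_1,\tau_2)$ hold iff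 all terms in them denote and $\tau^{\mathcal I}\in C^{\mathcal I}$, respectively $(\tau_1^{\mathcal I},\tau_2^{\mathcal I})\in r^{\mathcal I}$. An ontology is satisfiable iff all its axioms hold in some partial interpretation. The logic $\mathcal{ALCO}^{\iota*}$ has the same terms and concepts, without $\exists u.C$ and with an additional distinguished concept name $\mathsf T$; its axioms are $C\sqsubseteq D$, $C(\tau)$, $r(\tau_1,\tau_2)$, $\tau_1=\tau_2$, and its formulas are the Boolean combinations (with $\lnot,\land$) of axioms. A dual-domain interpretation $I$ consists of a non-empty outer domain $\Delta$, a (possibly empty) inner domain $\mathfrak d\subsetneq\Delta$, sets $A^I\subseteq\Delta$, relations $r^I\subseteq\Delta\times\Delta$, elements $a^I\in\Delta$ for all individual names $a$, and, for each definite description $\iota C$, an arbitrary element $d_{\iota C}\in\Delta\setminus\mathfrak d$. Here $\mathsf T^I=\mathfrak d$; $\{\tau\}^I=\{\tau^I\}$; $\lnot$ (complement in $\Delta$) and $\sqcap$ are as usual; $(\exists r.C)^I=\{d\in\Delta\mid \exists e\in\mathfrak d\cap C^I:(d,e)\in r^I\}$; and $(\iota C)^I=d$ if $\mathfrak d\cap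 C^I=\{d\}$, while $(\iota C)^I=d_{\iota C}$ if $\mathfrak d\cap C^I$ is not a singleton. $C\sqsubseteq D$ holds iff $\mathfrak d\cap C^I\subseteq D^I$. Under positive semantics, $C(\tau)$, $r(\tau_1,\tau_2)$, $\tau_1=\tau_2$ hold iff $\tau^I\in C^I$, $(\tau_1^I,\tau_2^I)\in r^I$, $\tau_1^I=\tau_2^I$, respectively; under negative semantics, it is required in addition that the values of all the displayed terms $\tau,\tau_1,\tau_2$ lie in $\mathfrak d$. Boolean connectives are interpreted classically. A formula is satisfiable under positive (negative) semantics iff it is satisfied under that semantics in some dual-domain interpretation. **Theorem.** For each of the two semantics, positive and negative, satisfiability of $\mathcal{ALCO}^{\iota*}$ formulas on dual-domain interpretations is polynomial-time (many-one) reducible to satisfiability of $\mathcal{ALCO}_u^{\iota}$ ontologies on partial interpretations: there is a polynomial-time computable map sending each formula $\varphi$ to an ontology $\mathcal O_\varphi$ such that $\varphi$ is satisfiable under the given semantics if and only if $\mathcal O_\varphi$ is satisfiable. -/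

import Mathlib

namespace FreeDL

/-- Concept names, role names and individual names are words over `{0,1}`; the three
countably infinite sets of names are three copies of this type, kept apart by the constructors
that use them. -/
abbrev Name : Type := List Bool

open Classical in
/-- The unique element of a set that is a singleton, `none` for every other set. -/
noncomputable def uniqueElem {α : Type} (S : Set α) : Option α :=
  if h : ∃ d, S = {d} then some h.choose else none

theorem uniqueElem_eq_some {α : Type} {S : Set α} {d : α} :
    uniqueElem S = some d ↔ S = {d} := by
  unfold uniqueElem
  split
  · rename_i h
    have hs := h.choose_spec
    rw [Option.some_inj]
    constructor
    · intro h'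
      rw [h'] at hs
      exact hs
    · intro h'
      exact (Set.singleton_eq_singleton_iff.1 (hs.symm.trans h'))
  · rename_i h
    exact ⟨fun h' => by simp at h', fun h' => (h ⟨d, h'⟩).elim⟩

/-! ### The logic `ALCO_u^ι` on partial interpretations -/

namespace ALCOu

mutual
/-- Terms `τ ::= a | ι C`. -/
inductive Term : Type
  | ind (a : Name) : Term
  | iota (C : Concept) : Term
/-- Concepts `C ::= A | {τ} | ¬C | C ⊓ D | ∃r.C | ∃u.C`, with `u` the universal role. -/
inductive Concept : Type
  | atom (A : Name) : Concept
  | nom (τ : Term) : Concept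
  | neg (C : Concept) : Concept
  | conj (C D : Concept) : Concept
  | ex (r : Name) (C : Concept) : Concept
  | exU (C : Concept) : Concept
end

/-- Axioms: concept inclusions `C ⊑ D` and assertions `C(τ)`, `r(τ₁,τ₂)`. -/
inductive Axm : Type
  | sub (C D : Concept) : Axm
  | inst (C : Concept) (τ : Term) : Axm
  | rel (r : Name) (τ₁ τ₂ : Term) : Axm

/-- An ontology is a finite set of axioms, presented by a list; neither order nor repetitions
matter for its models. -/
abbrev Ontology : Type := List Axm

/-- A partial interpretation: individual names are interpreted by a partial function. -/
structure Interp where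
  Dom : Type
  nonempty : Nonempty Dom
  con : Name → Set Dom
  role : Name → Set (Dom × Dom)
  ind : Name → Option Dom

mutual
/-- The value of a term in a partial interpretation, `none` if the term does not denote. -/
noncomputable def Term.val (I : Interp) : Term → Option I.Dom
  | .ind a => I.ind a
  | .iota C => uniqueElem (C.ext I)
/-- The extension of a concept in a partial interpretation. -/
noncomputable def Concept.ext (I : Interp) : Concept → Set I.Dom
  | .atom A => I.con A
  | .nom τ => {d | τ.val I = some d}
  | .neg C => (C.ext I)ᶜ
  | .conj C D => C.ext I ∩ D.ext I
  | .ex r C => {d | ∃ e ∈ C.ext I, (d, e) ∈ I.role r}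
  | .exU C => {_d | ∃ e, e ∈ C.ext I}
end

/-- Satisfaction of an axiom in a partial interpretation. -/
def Axm.Sat (I : Interp) : Axm → Prop
  | .sub C D => C.ext I ⊆ D.ext I
  | .inst C τ => ∃ d, τ.val I = some d ∧ d ∈ C.ext I
  | .rel r τ₁ τ₂ => ∃ d e, τ₁.val I = some d ∧ τ₂.val I = some e ∧ (d, e) ∈ I.role r

/-- An ontology is satisfiable if all its axioms are satisfied in some partial interpretation. -/
def Ontology.Satisfiable (O : Ontology) : Prop :=
  ∃ I : Interp, ∀ α ∈ O, α.Sat I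

end ALCOu

/-! ### The logic `ALCO^{ι*}` on dual-domain interpretations -/

namespace ALCOStar

mutual
/-- Terms `τ ::= a | ι C`. -/
inductive Term : Type
  | ind (a : Name) : Term
  | iota (C : Concept) : Term
/-- Concepts `C ::= A | T | {τ} | ¬C | C ⊓ D | ∃r.C`, where the distinguished concept name `T`
stands for the existing objects; there is no universal role. -/
inductive Concept : Type
  | atom (A : Name) : Concept
  | existing : Concept
  | nom (τ : Term) : Concept
  | neg (C : Concept) : Concept
  | conj (C D : Concept) : Concept
  | ex (r : Name) (C : Concept) : Concept
end

/-- Axioms: concept inclusions `C ⊑ D` and assertions `C(τ)`, `r(τ₁,τ₂)`, `τ₁ = τ₂`. -/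
inductive Axm : Type
  | sub (C D : Concept) : Axm
  | inst (C : Concept) (τ : Term) : Axm
  | rel (r : Name) (τ₁ τ₂ : Term) : Axm
  | eq (τ₁ τ₂ : Term) : Axm

/-- Formulas `φ ::= β | ¬(φ) | (φ ∧ φ)`, with `β` an axiom. -/
inductive Formula : Type
  | ax (β : Axm) : Formula
  | neg (φ : Formula) : Formula
  | and (φ ψ : Formula) : Formula

/-- A dual-domain interpretation: the outer domain `Dom`, the inner domain `inner`, which is a
proper and possibly empty subset of it, a total interpretation of the names in the outer domain,
and, for each definite description `ι C`, the arbitrary non-existing object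
`descr C ∈ Dom \ inner` that is the value of `ι C` whenever the description is not satisfied by
exactly one existing object. -/
structure Interp where
  Dom : Type
  nonempty : Nonempty Dom
  inner : Set Dom
  inner_ssubset : inner ⊂ Set.univ
  con : Name → Set Dom
  role : Name → Set (Dom × Dom)
  ind : Name → Dom
  descr : Concept → Dom
  descr_notMem : ∀ C, descr C ∉ inner

mutual
/-- The value of a term in a dual-domain interpretation. -/
noncomputable def Term.val (I : Interp) : Term → I.Dom
  | .ind a => I.ind a
  | .iota C => (uniqueElem (I.inner ∩ C.ext I)).getD (I.descr C)
/-- The extension of a concept in a dual-domain interpretation. -/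
noncomputable def Concept.ext (I : Interp) : Concept → Set I.Dom
  | .atom A => I.con A
  | .existing => I.inner
  | .nom τ => {τ.val I}
  | .neg C => (C.ext I)ᶜ
  | .conj C D => C.ext I ∩ D.ext I
  | .ex r C => {d | ∃ e ∈ I.inner ∩ C.ext I, (d, e) ∈ I.role r}
end

/-- Satisfaction of an axiom under positive semantics. -/
def Axm.SatPos (I : Interp) : Axm → Prop
  | .sub C D => ∀ d ∈ I.inner, d ∈ C.ext I → d ∈ D.ext I
  | .inst C τ => τ.val I ∈ C.ext I
  | .rel r τ₁ τ₂ => (τ₁.val I, τ₂.val I) ∈ I.role r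
  | .eq τ₁ τ₂ => τ₁.val I = τ₂.val I

/-- Satisfaction of an axiom under negative semantics. -/
def Axm.SatNeg (I : Interp) : Axm → Prop
  | .sub C D => ∀ d ∈ I.inner, d ∈ C.ext I → d ∈ D.ext I
  | .inst C τ => τ.val I ∈ I.inner ∧ τ.val I ∈ C.ext I
  | .rel r τ₁ τ₂ =>
      τ₁.val I ∈ I.inner ∧ τ₂.val I ∈ I.inner ∧ (τ₁.val I, τ₂.val I) ∈ I.role r
  | .eq τ₁ τ₂ => τ₁.val I ∈ I.inner ∧ τ₂.val I ∈ I.inner ∧ τ₁.val I = τ₂.val I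

/-- Satisfaction of a formula under positive semantics. -/
def Formula.SatPos (I : Interp) : Formula → Prop
  | .ax β => β.SatPos I
  | .neg φ => ¬ φ.SatPos I
  | .and φ ψ => φ.SatPos I ∧ ψ.SatPos I

/-- Satisfaction of a formula under negative semantics. -/
def Formula.SatNeg (I : Interp) : Formula → Prop
  | .ax β => β.SatNeg I
  | .neg φ => ¬ φ.SatNeg I
  | .and φ ψ => φ.SatNeg I ∧ ψ.SatNeg I

/-- Satisfiability on dual-domain interpretations under positive semantics. -/
def Formula.SatisfiablePos (φ : Formula) : Prop := ∃ I : Interp, φ.SatPos I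

/-- Satisfiability on dual-domain interpretations under negative semantics. -/
def Formula.SatisfiableNeg (φ : Formula) : Prop := ∃ I : Interp, φ.SatNeg I

end ALCOStar

/-! ### Formulas and ontologies as words over a finite alphabet -/

/-- The finite alphabet in which formulas and ontologies are written. -/
inductive Sym : Type
  | bit (b : Bool)
  | endName
  | ind
  | iota
  | close
  | atom
  | existing
  | nom
  | neg
  | conj
  | ex
  | exU
  | sub
  | comma
  | inst
  | rel
  | eq
  | fneg
  | fand
  deriving DecidableEq, Fintype

/-- A name is written as its word followed by an end marker. -/
def encName (a : Name) : List Sym := a.map Sym.bit ++ [Sym.endName]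

namespace ALCOu

mutual
/-- The word for a term: prefix notation, with the body of a definite description delimited. -/
def Term.enc : Term → List Sym
  | .ind a => .ind :: encName a
  | .iota C => .iota :: (C.enc ++ [.close])
/-- The word for a concept, in prefix notation. -/
def Concept.enc : Concept → List Sym
  | .atom A => .atom :: encName A
  | .nom τ => .nom :: τ.enc
  | .neg C => .neg :: C.enc
  | .conj C D => .conj :: (C.enc ++ D.enc)
  | .ex r C => .ex :: (encName r ++ C.enc)
  | .exU C => .exU :: C.enc
end

/-- The word for an axiom. -/
def Axm.enc : Axm → List Sym
  | .sub C D => .sub :: (C.enc ++ .comma :: D.enc)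
  | .inst C τ => .inst :: (C.enc ++ τ.enc)
  | .rel r τ₁ τ₂ => .rel :: (encName r ++ (τ₁.enc ++ τ₂.enc))

/-- The word for an ontology: the concatenation of the words of its axioms. -/
def Ontology.enc (O : Ontology) : List Sym := O.flatMap Axm.enc

end ALCOu

namespace ALCOStar

mutual
/-- The word for a term: prefix notation, with the body of a definite description delimited. -/
def Term.enc : Term → List Sym
  | .ind a => .ind :: encName a
  | .iota C => .iota :: (C.enc ++ [.close])
/-- The word for a concept, in prefix notation. -/
def Concept.enc : Concept → List Sym
  | .atom A => .atom :: encName A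
  | .existing => [.existing]
  | .nom τ => .nom :: τ.enc
  | .neg C => .neg :: C.enc
  | .conj C D => .conj :: (C.enc ++ D.enc)
  | .ex r C => .ex :: (encName r ++ C.enc)
end

/-- The word for an axiom. -/
def Axm.enc : Axm → List Sym
  | .sub C D => .sub :: (C.enc ++ .comma :: D.enc)
  | .inst C τ => .inst :: (C.enc ++ τ.enc)
  | .rel r τ₁ τ₂ => .rel :: (encName r ++ (τ₁.enc ++ τ₂.enc))
  | .eq τ₁ τ₂ => .eq :: (τ₁.enc ++ τ₂.enc)

/-- The word for a formula, in prefix notation. -/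
def Formula.enc : Formula → List Sym
  | .ax β => β.enc
  | .neg φ => .fneg :: φ.enc
  | .and φ ψ => .fand :: (φ.enc ++ ψ.enc)

end ALCOStar

/-! The words determine the formulas and ontologies that they encode. -/

theorem encName_append_inj {a b : Name} {s t : List Sym}
    (h : encName a ++ s = encName b ++ t) : a = b ∧ s = t := by
  induction a generalizing b with
  | nil => cases b <;> simp_all [encName]
  | cons x a ih =>
    cases b with
    | nil => simp [encName] at h
    | cons y b =>
      simp only [encName, List.map_cons, List.cons_append, List.cons.injEq, Sym.bit.injEq] at h
      obtain ⟨h1, h2⟩ := ih h.2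
      exact ⟨by rw [h.1, h1], h2⟩

namespace ALCOu

mutual
theorem Term.enc_append_inj : ∀ (τ σ : Term) (s t : List Sym),
    τ.enc ++ s = σ.enc ++ t → τ = σ ∧ s = t
  | .ind a, σ, s, t, h => by
    cases σ with
    | ind b =>
      simp only [Term.enc, List.cons_append, List.cons.injEq, true_and] at h
      simpa using encName_append_inj h
    | iota D => simp [Term.enc] at h
  | .iota C, σ, s, t, h => by
    cases σ with
    | ind b => simp [Term.enc] at h
    | iota D =>
      simp only [Term.enc, List.cons_append, List.cons.injEq, true_and, List.append_assoc] at h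
      simpa using Concept.enc_append_inj C D _ _ h
theorem Concept.enc_append_inj : ∀ (C D : Concept) (s t : List Sym),
    C.enc ++ s = D.enc ++ t → C = D ∧ s = t
  | .atom A, D, s, t, h => by
    cases D <;> simp only [Concept.enc, List.cons_append, List.cons.injEq, reduceCtorEq,
      true_and, false_and] at h
    simpa using encName_append_inj h
  | .nom τ, D, s, t, h => by
    cases D <;> simp only [Concept.enc, List.cons_append, List.cons.injEq, reduceCtorEq,
      true_and, false_and] at h
    simpa using Term.enc_append_inj τ _ _ _ h
  | .neg C, D, s, t, h => by
    cases D <;> simp only [Concept.enc, List.cons_append, List.cons.injEq, reduceCtorEq,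
      true_and, false_and] at h
    simpa using Concept.enc_append_inj C _ _ _ h
  | .conj C C', D, s, t, h => by
    cases D <;> simp only [Concept.enc, List.cons_append, List.cons.injEq, reduceCtorEq,
      true_and, false_and, List.append_assoc] at h
    obtain ⟨h1, h2⟩ := Concept.enc_append_inj C _ _ _ h
    obtain ⟨h3, h4⟩ := Concept.enc_append_inj C' _ _ _ h2
    simp [h1, h3, h4]
  | .ex r C, D, s, t, h => by
    cases D <;> simp only [Concept.enc, List.cons_append, List.cons.injEq, reduceCtorEq,
      true_and, false_and, List.append_assoc] at h
    obtain ⟨h1, h2⟩ := encName_append_inj h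
    obtain ⟨h3, h4⟩ := Concept.enc_append_inj C _ _ _ h2
    simp [h1, h3, h4]
  | .exU C, D, s, t, h => by
    cases D <;> simp only [Concept.enc, List.cons_append, List.cons.injEq, reduceCtorEq,
      true_and, false_and] at h
    simpa using Concept.enc_append_inj C _ _ _ h
end

theorem Axm.enc_append_inj (α β : Axm) (s t : List Sym) (h : α.enc ++ s = β.enc ++ t) :
    α = β ∧ s = t := by
  cases α <;> cases β <;> simp only [Axm.enc, List.cons_append, List.cons.injEq, reduceCtorEq,
      true_and, false_and, List.append_assoc] at h
  · obtain ⟨h1, h2⟩ := Concept.enc_append_inj _ _ _ _ h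
    simp only [List.cons.injEq, true_and] at h2
    obtain ⟨h3, h4⟩ := Concept.enc_append_inj _ _ _ _ h2
    simp [h1, h3, h4]
  · obtain ⟨h1, h2⟩ := Concept.enc_append_inj _ _ _ _ h
    obtain ⟨h3, h4⟩ := Term.enc_append_inj _ _ _ _ h2
    simp [h1, h3, h4]
  · obtain ⟨h0, h⟩ := encName_append_inj h
    obtain ⟨h1, h2⟩ := Term.enc_append_inj _ _ _ _ h
    obtain ⟨h3, h4⟩ := Term.enc_append_inj _ _ _ _ h2
    simp [h0, h1, h3, h4]

theorem Ontology.enc_injective : Function.Injective Ontology.enc := by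
  intro O
  induction O with
  | nil =>
    intro P h
    cases P with
    | nil => rfl
    | cons β P => cases β <;> simp [Ontology.enc, Axm.enc] at h
  | cons α O ih =>
    intro P h
    cases P with
    | nil => cases α <;> simp [Ontology.enc, Axm.enc] at h
    | cons β P =>
      simp only [Ontology.enc, List.flatMap_cons] at h
      obtain ⟨h1, h2⟩ := Axm.enc_append_inj _ _ _ _ h
      rw [h1, ih h2]

end ALCOu

namespace ALCOStar

mutual
theorem Term.enc_append_inj : ∀ (τ σ : Term) (s t : List Sym),
    τ.enc ++ s = σ.enc ++ t → τ = σ ∧ s = t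
  | .ind a, σ, s, t, h => by
    cases σ with
    | ind b =>
      simp only [Term.enc, List.cons_append, List.cons.injEq, true_and] at h
      simpa using encName_append_inj h
    | iota D => simp [Term.enc] at h
  | .iota C, σ, s, t, h => by
    cases σ with
    | ind b => simp [Term.enc] at h
    | iota D =>
      simp only [Term.enc, List.cons_append, List.cons.injEq, true_and, List.append_assoc] at h
      simpa using Concept.enc_append_inj C D _ _ h
theorem Concept.enc_append_inj : ∀ (C D : Concept) (s t : List Sym),
    C.enc ++ s = D.enc ++ t → C = D ∧ s = t
  | .atom A, D, s, t, h => by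
    cases D <;> simp only [Concept.enc, List.cons_append, List.cons.injEq, reduceCtorEq,
      true_and, false_and] at h
    simpa using encName_append_inj h
  | .existing, D, s, t, h => by
    cases D <;> simp_all [Concept.enc]
  | .nom τ, D, s, t, h => by
    cases D <;> simp only [Concept.enc, List.cons_append, List.cons.injEq, reduceCtorEq,
      true_and, false_and] at h
    simpa using Term.enc_append_inj τ _ _ _ h
  | .neg C, D, s, t, h => by
    cases D <;> simp only [Concept.enc, List.cons_append, List.cons.injEq, reduceCtorEq,
      true_and, false_and] at h
    simpa using Concept.enc_append_inj C _ _ _ h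
  | .conj C C', D, s, t, h => by
    cases D <;> simp only [Concept.enc, List.cons_append, List.cons.injEq, reduceCtorEq,
      true_and, false_and, List.append_assoc] at h
    obtain ⟨h1, h2⟩ := Concept.enc_append_inj C _ _ _ h
    obtain ⟨h3, h4⟩ := Concept.enc_append_inj C' _ _ _ h2
    simp [h1, h3, h4]
  | .ex r C, D, s, t, h => by
    cases D <;> simp only [Concept.enc, List.cons_append, List.cons.injEq, reduceCtorEq,
      true_and, false_and, List.append_assoc] at h
    obtain ⟨h1, h2⟩ := encName_append_inj h
    obtain ⟨h3, h4⟩ := Concept.enc_append_inj C _ _ _ h2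
    simp [h1, h3, h4]
end

theorem Axm.enc_append_inj (α β : Axm) (s t : List Sym) (h : α.enc ++ s = β.enc ++ t) :
    α = β ∧ s = t := by
  cases α <;> cases β <;> simp only [Axm.enc, List.cons_append, List.cons.injEq, reduceCtorEq,
      true_and, false_and, List.append_assoc] at h
  · obtain ⟨h1, h2⟩ := Concept.enc_append_inj _ _ _ _ h
    simp only [List.cons.injEq, true_and] at h2
    obtain ⟨h3, h4⟩ := Concept.enc_append_inj _ _ _ _ h2
    simp [h1, h3, h4]
  · obtain ⟨h1, h2⟩ := Concept.enc_append_inj _ _ _ _ h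
    obtain ⟨h3, h4⟩ := Term.enc_append_inj _ _ _ _ h2
    simp [h1, h3, h4]
  · obtain ⟨h0, h⟩ := encName_append_inj h
    obtain ⟨h1, h2⟩ := Term.enc_append_inj _ _ _ _ h
    obtain ⟨h3, h4⟩ := Term.enc_append_inj _ _ _ _ h2
    simp [h0, h1, h3, h4]
  · obtain ⟨h1, h2⟩ := Term.enc_append_inj _ _ _ _ h
    obtain ⟨h3, h4⟩ := Term.enc_append_inj _ _ _ _ h2
    simp [h1, h3, h4]

theorem Formula.enc_append_inj (φ ψ : Formula) (s t : List Sym)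
    (h : φ.enc ++ s = ψ.enc ++ t) : φ = ψ ∧ s = t := by
  induction φ generalizing ψ s t with
  | ax β =>
    cases ψ with
    | ax γ => simpa using Axm.enc_append_inj _ _ _ _ h
    | neg ψ => cases β <;> simp [Formula.enc, Axm.enc] at h
    | and ψ χ => cases β <;> simp [Formula.enc, Axm.enc] at h
  | neg φ ih =>
    cases ψ with
    | ax γ => cases γ <;> simp [Formula.enc, Axm.enc] at h
    | neg ψ =>
      simp only [Formula.enc, List.cons_append, List.cons.injEq, true_and] at h
      simpa using ih _ _ _ h
    | and ψ χ => simp [Formula.enc] at h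
  | and φ φ' ih ih' =>
    cases ψ with
    | ax γ => cases γ <;> simp [Formula.enc, Axm.enc] at h
    | neg ψ => simp [Formula.enc] at h
    | and ψ χ =>
      simp only [Formula.enc, List.cons_append, List.cons.injEq, true_and,
        List.append_assoc] at h
      obtain ⟨h1, h2⟩ := ih _ _ _ h
      obtain ⟨h3, h4⟩ := ih' _ _ _ h2
      simp [h1, h3, h4]

theorem Formula.enc_injective : Function.Injective Formula.enc := fun φ ψ h =>
  (Formula.enc_append_inj φ ψ [] [] (by simpa using h)).1

end ALCOStar

/-- Polynomial-time many-one reducibility of the decision problem `P` on `α` to the decision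
problem `Q` on `β`, relative to encodings of the instances as words over a finite alphabet:
some map, computed on the encodings by a Turing machine whose number of steps is bounded by a
polynomial in the length of the input word, preserves and reflects the answer. -/
def PolyTimeReducible {α β : Type} (ea : α → List Sym) (eb : β → List Sym)
    (P : α → Prop) (Q : β → Prop) : Prop :=
  ∃ f : α → β, Nonempty (Turing.TM2ComputableInPolyTime ea eb f) ∧ ∀ a, P a ↔ Q (f a)

end FreeDL

-- The ontology for `φ` describes the outer domain. A concept name `innerC` marks the inner domain,
-- and every term `τ` occurring in `φ` gets an individual name `nameOf τ` meant to denote its value.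
-- Nominals `{τ}` turn into nominals of these names, and `∃r` is restricted to `innerC`. The
-- universal role turns each axiom into a concept `∃u.D` or `¬∃u.D`, whose extension is empty or
-- everything. Boolean combinations of axioms thus become Boolean combinations of concepts, and one
-- inclusion from the universal concept asserts the whole formula together with `∃u.¬innerC`, as the
-- inner domain must be proper.
--
-- What remains is to fix the name `n` of `ιC`. One assertion does it: `n` is an instance of
-- `{ι({ι(innerC ⊓ C)} ⊔ ({n} ⊓ ¬innerC))}`. If `innerC ⊓ C` has exactly one element, this forces
-- `n` to be that element; otherwise the inner nominal is empty and `n` only has to lie outside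
-- `innerC`, which matches the arbitrary value of a failing description (`sat_defAxm_iota`). A
-- dual-domain model yields a partial one by letting each name denote the value of its term;
-- conversely, the names in a partial model supply the values of individual names and of failing
-- descriptions (`exists_satFormula_iff`).
--
-- For the complexity, the reduction is programmed on a machine with a stack of tasks, which is
-- simulated by a Turing machine with three steps per task (`computableInPolyTime`). One pass
-- translates `φ`; a second pass writes the defining axiom at each term occurrence. Each occurrence
-- costs linear time, so the run is quadratic (`reach_reversed_output`, `reduction_computable`).

namespace FreeDL

/-! ### Task machines

A task machine has finitely many data stacks and a control stack of tasks. In each step it removes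
the top task, pops a symbol from the data stack which that task reads (if any), pushes symbols on
data stacks and replaces the task by a list of new tasks. It stops when no task is left. -/

/-- A task machine with data stacks `D`, tasks `T` and stack alphabet `S`. -/
structure TaskMachine (D T S : Type) where
  /-- the stack read by a task -/
  src : T → Option D
  /-- the symbols pushed and the tasks created by a task, given the symbol read -/
  act : T → Option S → List (D × S) × List T
  /-- the initial task -/
  start : T
  /-- the input stack -/
  input : D
  /-- the output stack -/
  output : D

namespace TaskMachine

variable {D T S : Type} [DecidableEq D] (M : TaskMachine D T S)

/-- The symbol obtained by popping a stack. -/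
def popSym (f : D → List S) : Option D → Option S
  | none => none
  | some d => (f d).head?

/-- The stacks after popping a stack. -/
def popStk (f : D → List S) : Option D → D → List S
  | none => f
  | some d => Function.update f d (f d).tail

/-- The stacks after a list of pushes. -/
def pushes (l : List (D × S)) (f : D → List S) : D → List S :=
  l.foldl (fun g p => Function.update g p.1 (p.2 :: g p.1)) f

/-- Reachability in at most the given number of steps. -/
inductive Reach : ℕ → List T → (D → List S) → List T → (D → List S) → Prop
  | refl (n : ℕ) (c : List T) (f : D → List S) : Reach n c f c f
  | step {n : ℕ} {t : T} {c c' : List T} {f f' : D → List S}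
      (h : Reach n ((M.act t (popSym f (M.src t))).2 ++ c)
        (pushes (M.act t (popSym f (M.src t))).1 (popStk f (M.src t))) c' f') :
      Reach (n + 1) (t :: c) f c' f'

variable {M} in
theorem Reach.mono {m n : ℕ} {c c' : List T} {f f' : D → List S} (h : M.Reach m c f c' f')
    (hmn : m ≤ n) : M.Reach n c f c' f' := by
  induction h generalizing n with
  | refl m c f => exact .refl _ _ _
  | step h ih =>
    obtain ⟨k, rfl⟩ := Nat.exists_eq_add_of_lt (Nat.lt_of_succ_le hmn)
    exact .step (ih (by omega))

variable {M} in
theorem Reach.trans {m n : ℕ} {c c' c'' : List T} {f f' f'' : D → List S}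
    (h : M.Reach m c f c' f') (h' : M.Reach n c' f' c'' f'') : M.Reach (m + n) c f c'' f'' := by
  induction h with
  | refl m c f => exact h'.mono (by omega)
  | @step k _ _ _ _ _ h ih => exact (Reach.step (ih h')).mono (by omega)

/-! #### Task machines as Turing machines -/

/-- The alphabets of the control stack and of the data stacks. -/
@[reducible] def Alph (D T S : Type) : Option D → Type
  | none => T
  | some _ => S

/-- The labels of the Turing machine. -/
inductive Lbl (T S : Type) : Type
  | main
  | loop
  | exec (t : T)
  | run (t : T) (s : Option S)
  | fin
  deriving Fintype

open Turing.TM2.Stmt in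
/-- The statement that pushes symbols on data stacks and then continues with `q`. -/
def pushStmt (q : Turing.TM2.Stmt (Alph D T S) (Lbl T S) (Option T × Option S)) :
    List (D × S) → Turing.TM2.Stmt (Alph D T S) (Lbl T S) (Option T × Option S)
  | [] => q
  | p :: l => push (some p.1) (fun _ => p.2) (pushStmt q l)

open Turing.TM2.Stmt in
/-- The statement that pushes tasks on the control stack and then continues with `q`. -/
def taskStmt (q : Turing.TM2.Stmt (Alph D T S) (Lbl T S) (Option T × Option S)) :
    List T → Turing.TM2.Stmt (Alph D T S) (Lbl T S) (Option T × Option S)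
  | [] => q
  -- The head of the list is pushed last, so it is executed first.
  | t :: l => taskStmt (push none (fun _ => t) q) l

open Turing.TM2.Stmt in
/-- The program of the Turing machine. -/
def prog : Lbl T S → Turing.TM2.Stmt (Alph D T S) (Lbl T S) (Option T × Option S)
  | .main => push none (fun _ => M.start) (goto fun _ => .loop)
  -- On an empty control stack the registers become `(none, none)`, the initial state, which
  -- `haltList` prescribes for the final configuration.
  | .loop => pop none (fun _ o => (o, none)) (goto fun v => v.1.elim .fin .exec)
  | .exec t =>
    match M.src t with
    | none => load (fun _ => (none, none)) (goto fun _ => .run t none)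
    -- The statement to execute depends on the symbol read, so the symbol moves from the register
    -- into the label.
    | some d => pop (some d) (fun _ o => (none, o)) (goto fun v => .run t v.2)
  | .run t s => pushStmt (taskStmt (goto fun _ => .loop) (M.act t s).2) (M.act t s).1
  | .fin => halt

/-- The stacks of the Turing machine. -/
def tapes (c : List T) (f : D → List S) : ∀ k, List (Alph D T S k)
  | none => c
  | some d => f d

theorem update_tapes_none (c c' : List T) (f : D → List S) :
    Function.update (tapes c f) none c' = tapes c' f := by
  funext k
  cases k <;> simp [tapes]

theorem update_tapes_some (c : List T) (f : D → List S) (d : D) (s : List S) :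
    Function.update (tapes c f) (some d) s = tapes c (Function.update f d s) := by
  funext k
  cases k with
  | none => simp [tapes]
  | some e =>
    by_cases h : e = d
    · subst h; simp [tapes]
    · simp [tapes, h]

theorem stepAux_taskStmt (q : Turing.TM2.Stmt (Alph D T S) (Lbl T S) (Option T × Option S))
    (l : List T) (v : Option T × Option S) (c : List T) (f : D → List S) :
    Turing.TM2.stepAux (taskStmt q l) v (tapes c f) =
      Turing.TM2.stepAux q v (tapes (l ++ c) f) := by
  induction l generalizing q c with
  | nil => rfl
  | cons t l ih =>
    rw [taskStmt, ih, Turing.TM2.stepAux.eq_1, update_tapes_none]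
    rfl

theorem stepAux_pushStmt (q : Turing.TM2.Stmt (Alph D T S) (Lbl T S) (Option T × Option S))
    (l : List (D × S)) (v : Option T × Option S) (c : List T) (f : D → List S) :
    Turing.TM2.stepAux (pushStmt q l) v (tapes c f) =
      Turing.TM2.stepAux q v (tapes c (pushes l f)) := by
  induction l generalizing f with
  | nil => rfl
  | cons p l ih =>
    rw [pushStmt, Turing.TM2.stepAux.eq_1, update_tapes_some, ih]
    rfl

/-- The three steps are those at the labels `loop`, `exec` and `run`. -/
theorem step_task (t : T) (c : List T) (f : D → List S) (v : Option T × Option S) :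
    ∃ v', (flip bind (Turing.TM2.step M.prog))^[3] (some ⟨some .loop, v, tapes (t :: c) f⟩) =
      some ⟨some .loop, v', tapes ((M.act t (popSym f (M.src t))).2 ++ c)
        (pushes (M.act t (popSym f (M.src t))).1 (popStk f (M.src t)))⟩ := by
  refine ⟨(none, popSym f (M.src t)), ?_⟩
  simp only [Function.iterate_succ, Function.iterate_zero, Function.comp_apply, id_eq, flip,
    Option.bind_eq_bind, Option.bind_some, Turing.TM2.step.eq_2, prog, Turing.TM2.stepAux.eq_3,
    Turing.TM2.stepAux.eq_6, update_tapes_none]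
  have h1 : (tapes (t :: c) f none : List T) = t :: c := rfl
  simp only [h1, List.head?_cons, Option.elim_some, List.tail_cons]
  cases h : M.src t with
  | none =>
    simp only [prog, Turing.TM2.stepAux.eq_4, Turing.TM2.stepAux.eq_6,
      Turing.TM2.step.eq_2, stepAux_pushStmt, stepAux_taskStmt, popSym, popStk]
  | some d =>
    simp only [prog, Turing.TM2.stepAux.eq_3, Turing.TM2.stepAux.eq_6,
      Turing.TM2.step.eq_2, stepAux_pushStmt, stepAux_taskStmt, popSym, popStk,
      update_tapes_some]
    rfl

variable {M} in
theorem Reach.evals {n : ℕ} {c c' : List T} {f f' : D → List S} (h : M.Reach n c f c' f')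
    (v : Option T × Option S) :
    ∃ k ≤ 3 * n, ∃ v', (flip bind (Turing.TM2.step M.prog))^[k]
      (some ⟨some .loop, v, tapes c f⟩) = some ⟨some .loop, v', tapes c' f'⟩ := by
  induction h generalizing v with
  | refl n c f => exact ⟨0, by omega, v, rfl⟩
  | @step n t c c' f f' h ih =>
    obtain ⟨v₁, h₁⟩ := M.step_task t c f v
    obtain ⟨k, hk, v₂, h₂⟩ := ih v₁
    exact ⟨k + 3, by omega, v₂, by rw [Function.iterate_add_apply, h₁, h₂]⟩

/-- The Turing machine of a task machine. -/
def toFinTM2 [Fintype D] [Fintype T] [Fintype S] : Turing.FinTM2 where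
  K := Option D
  k₀ := some M.input
  k₁ := some M.output
  Γ := Alph D T S
  Λ := Lbl T S
  main := .main
  σ := Option T × Option S
  initialState := (none, none)
  Γk₀Fin := inferInstanceAs (Fintype S)
  m := M.prog

theorem initList_toFinTM2 [Fintype D] [Fintype T] [Fintype S] (w : List S) :
    Turing.initList M.toFinTM2 w =
      ⟨some .main, (none, none), tapes [] (Function.update (fun _ => []) M.input w)⟩ := by
  unfold Turing.initList
  congr 1
  funext k
  cases k with
  | none => rfl
  | some d =>
    by_cases h : d = M.input
    · subst h
      simp only [tapes, toFinTM2, Function.update_self]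
      exact dif_pos rfl
    · have h' : ¬ (some d : Option D) = some M.input := by simpa using h
      simp only [tapes, toFinTM2, Function.update_of_ne h]
      exact dif_neg h'

theorem haltList_toFinTM2 [Fintype D] [Fintype T] [Fintype S] (w : List S) :
    Turing.haltList M.toFinTM2 w =
      ⟨none, (none, none), tapes [] (Function.update (fun _ => []) M.output w)⟩ := by
  unfold Turing.haltList
  congr 1
  funext k
  cases k with
  | none => rfl
  | some d =>
    by_cases h : d = M.output
    · subst h
      simp only [tapes, toFinTM2, Function.update_self]
      exact dif_pos rfl
    · have h' : ¬ (some d : Option D) = some M.output := by simpa using h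
      simp only [tapes, toFinTM2, Function.update_of_ne h]
      exact dif_neg h'

/-- A map that a task machine computes in polynomially many steps is computable in polynomial
time. -/
theorem computableInPolyTime [Fintype D] [Fintype T] [Fintype S] {α β : Type}
    (ea : α → List S) (eb : β → List S) (g : α → β) (p : Polynomial ℕ)
    (h : ∀ a, M.Reach (p.eval (ea a).length) [M.start]
      (Function.update (fun _ => []) M.input (ea a)) []
      (Function.update (fun _ => []) M.output (eb (g a)))) :
    Nonempty (Turing.TM2ComputableInPolyTime ea eb g) := by
  have key : ∀ a, ∃ k ≤ 3 * p.eval (ea a).length + 3,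
      (flip bind (Turing.TM2.step M.prog))^[k] (some ⟨some .main, (none, none),
        tapes [] (Function.update (fun _ => []) M.input (ea a))⟩) =
      some ⟨none, (none, none),
        tapes [] (Function.update (fun _ => []) M.output (eb (g a)))⟩ := by
    intro a
    obtain ⟨k, hk, v, hv⟩ := (h a).evals (none, none)
    -- One step at `main` pushes the initial task; two more, at `loop` with an empty control stack
    -- and at `fin`, halt.
    refine ⟨2 + k + 1, by omega, ?_⟩
    rw [Function.iterate_add_apply, Function.iterate_one]
    simp only [flip, Option.bind_eq_bind, Option.bind_some, Turing.TM2.step.eq_2, prog,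
      Turing.TM2.stepAux.eq_1, Turing.TM2.stepAux.eq_6, update_tapes_none]
    rw [Function.iterate_add_apply]
    have h1 : ∀ f : D → List S, (tapes [] f none : List T) = [] := fun _ => rfl
    rw [h1]
    erw [hv]
    simp only [Function.iterate_succ, Function.iterate_zero, Function.comp_apply, id_eq, flip,
      Option.bind_some, Turing.TM2.step.eq_2, prog, Turing.TM2.stepAux.eq_3,
      Turing.TM2.stepAux.eq_6, update_tapes_none, h1, List.head?_nil, List.tail_nil,
      Option.elim_none, Turing.TM2.stepAux.eq_7]
  refine ⟨{
    tm := M.toFinTM2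
    inputAlphabet := Equiv.refl S
    outputAlphabet := Equiv.refl S
    time := Polynomial.C 3 * p + Polynomial.C 3
    outputsFun := fun a => ?_ }⟩
  refine ⟨⟨(key a).choose, ?_⟩, ?_⟩
  · have := (key a).choose_spec.2
    simp only [Equiv.refl, Option.map_some]
    erw [List.map_id, List.map_id, initList_toFinTM2, haltList_toFinTM2]
    exact this
  · simpa using (key a).choose_spec.1

end TaskMachine

/-! ### The reduction -/

/-- A code of constant length for the symbols. -/
def Sym.code : Sym → List Bool
  | .bit false => [false, false, false, false, false]
  | .bit true => [false, false, false, false, true]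
  | .endName => [false, false, false, true, false]
  | .ind => [false, false, false, true, true]
  | .iota => [false, false, true, false, false]
  | .close => [false, false, true, false, true]
  | .atom => [false, false, true, true, false]
  | .existing => [false, false, true, true, true]
  | .nom => [false, true, false, false, false]
  | .neg => [false, true, false, false, true]
  | .conj => [false, true, false, true, false]
  | .ex => [false, true, false, true, true]
  | .exU => [false, true, true, false, false]
  | .sub => [false, true, true, false, true]
  | .comma => [false, true, true, true, false]
  | .inst => [false, true, true, true, true]
  | .rel => [true, false, false, false, false]
  | .eq => [true, false, false, false, true]
  | .fneg => [true, false, false, true, false]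
  | .fand => [true, false, false, true, true]

theorem Sym.code_length (s : Sym) : s.code.length = 5 := by
  revert s; decide

theorem Sym.code_injective : Function.Injective Sym.code := by
  intro s t
  revert s t; decide

/-- All codes have length 5, so a concatenation of codes splits into blocks in only one way. -/
theorem flatMap_code_injective :
    Function.Injective fun w : List Sym => w.flatMap Sym.code := by
  intro v
  induction v with
  | nil =>
    intro w h
    cases w with
    | nil => rfl
    | cons t w =>
      have := congrArg List.length h
      simp [Sym.code_length] at this
      omega
  | cons s v ih =>
    intro w h
    cases w with
    | nil =>
      have := congrArg List.length h
      simp [Sym.code_length] at this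
    | cons t w =>
      simp only [List.flatMap_cons] at h
      obtain ⟨h1, h2⟩ := List.append_inj h (by rw [Sym.code_length, Sym.code_length])
      rw [Sym.code_injective h1, ih h2]

/-- The individual name that stands for a term: the code of its word. -/
def nameOf (τ : ALCOStar.Term) : Name := τ.enc.flatMap Sym.code

theorem nameOf_injective : Function.Injective nameOf := fun τ σ h =>
  (ALCOStar.Term.enc_append_inj τ σ [] [] (by simpa using flatMap_code_injective h)).1

open ALCOu.Concept (atom nom neg conj ex exU)

/-- The concept name that stands for the inner domain. -/
def innerC : ALCOu.Concept := atom []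

/-- The universal concept. -/
def topC : ALCOu.Concept := neg (conj innerC (neg innerC))

/-- The nominal of the name that stands for a term. -/
def nomOf (τ : ALCOStar.Term) : ALCOu.Concept := nom (.ind (nameOf τ))

/-- The translation of concepts. -/
def trConcept : ALCOStar.Concept → ALCOu.Concept
  -- The prefix keeps these names apart from `[]`, the name of the inner domain.
  | .atom A => atom (true :: A)
  | .existing => innerC
  | .nom τ => nomOf τ
  | .neg C => neg (trConcept C)
  | .conj C D => conj (trConcept C) (trConcept D)
  -- Reversal is a bijective renaming of roles. It is used because the machine buffers role names on
  -- a stack, from which they come out reversed.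
  | .ex r C => ex r.reverse (conj innerC (trConcept C))

/-- Relativization to the inner domain, which is applied under negative semantics only. -/
def guard (negative : Bool) (C : ALCOu.Concept) : ALCOu.Concept :=
  if negative then conj innerC C else C

/-- The translation of axioms into concepts that are empty or universal. -/
def trAxm (negative : Bool) : ALCOStar.Axm → ALCOu.Concept
  | .sub C D => neg (exU (conj innerC (conj (trConcept C) (neg (trConcept D)))))
  | .inst C τ => exU (guard negative (conj (trConcept C) (nomOf τ)))
  | .rel r τ₁ τ₂ =>
      exU (guard negative (conj (nomOf τ₁) (ex r.reverse (guard negative (nomOf τ₂)))))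
  -- One guard covers both terms, since their values coincide.
  | .eq τ₁ τ₂ => exU (guard negative (conj (nomOf τ₁) (nomOf τ₂)))

/-- The translation of formulas into concepts that are empty or universal. -/
def trFormula (negative : Bool) : ALCOStar.Formula → ALCOu.Concept
  | .ax β => trAxm negative β
  | .neg φ => neg (trFormula negative φ)
  | .and φ ψ => conj (trFormula negative φ) (trFormula negative ψ)

namespace ALCOStar

mutual
/-- The list of all terms that occur in a term. -/
def Term.terms : Term → List Term
  | .ind a => [.ind a]
  | .iota C => .iota C :: C.terms
/-- The list of all terms that occur in a concept. -/
def Concept.terms : Concept → List Term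
  | .atom _ => []
  | .existing => []
  | .nom τ => τ.terms
  | .neg C => C.terms
  | .conj C D => C.terms ++ D.terms
  | .ex _ C => C.terms
end

/-- The list of all terms that occur in an axiom. -/
def Axm.terms : Axm → List Term
  | .sub C D => C.terms ++ D.terms
  | .inst C τ => C.terms ++ τ.terms
  | .rel _ τ₁ τ₂ => τ₁.terms ++ τ₂.terms
  | .eq τ₁ τ₂ => τ₁.terms ++ τ₂.terms

/-- The list of all terms that occur in a formula. -/
def Formula.terms : Formula → List Term
  | .ax β => β.terms
  | .neg φ => φ.terms
  | .and φ ψ => φ.terms ++ ψ.terms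

end ALCOStar

/-- The axiom that fixes the value of the name that stands for a term: the name denotes and, if
the term is a definite description `ι C`, the name denotes the existing object that is the only
one to satisfy `C`, or a non-existing object if there is no such object. -/
def defAxm (τ : ALCOStar.Term) : ALCOu.Axm :=
  match τ with
  | .ind _ => .inst topC (.ind (nameOf τ))
  | .iota C =>
    -- By De Morgan, the outer description ranges over the union of `{ι(innerC ⊓ C)}` and `{n} ⊓
    -- ¬innerC`, with `n` the name of the term; the assertion says that this union is exactly `{n}`.
    .inst (nom (.iota (neg (conj (neg (nom (.iota (conj innerC (trConcept C)))))
      (neg (conj (nomOf τ) (neg innerC))))))) (.ind (nameOf τ))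

/-- The ontology of a formula. -/
def reduction (negative : Bool) (φ : ALCOStar.Formula) : ALCOu.Ontology :=
  -- The conjunct `∃u.¬innerC` expresses that the inner domain is a proper subset.
  .sub topC (conj (exU (neg innerC)) (trFormula negative φ)) :: φ.terms.map defAxm

/-! ### Correctness of the reduction -/

/-- A partial interpretation represents a dual-domain interpretation with the same domain, as far
as concept and role names are concerned. -/
structure Represents (J : ALCOu.Interp) (I : ALCOStar.Interp) (e : J.Dom ≃ I.Dom) : Prop where
  inner : ∀ d, d ∈ J.con [] ↔ e d ∈ I.inner
  con : ∀ A d, d ∈ J.con (true :: A) ↔ e d ∈ I.con A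
  role : ∀ r d d', (d, d') ∈ J.role r.reverse ↔ (e d, e d') ∈ I.role r

/-- The name that stands for a term denotes the value of the term. -/
def NameCorrect (J : ALCOu.Interp) (I : ALCOStar.Interp) (e : J.Dom ≃ I.Dom)
    (τ : ALCOStar.Term) : Prop :=
  J.ind (nameOf τ) = some (e.symm (τ.val I))

section

variable {J : ALCOu.Interp} {I : ALCOStar.Interp} {e : J.Dom ≃ I.Dom}

theorem ALCOStar.Term.self_mem_terms (τ : ALCOStar.Term) : τ ∈ τ.terms := by
  cases τ <;> simp [ALCOStar.Term.terms]

theorem ext_topC (J : ALCOu.Interp) : topC.ext J = Set.univ := by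
  ext d
  simp [topC, ALCOu.Concept.ext]

theorem mem_ext_innerC (h : Represents J I e) (d : J.Dom) :
    d ∈ innerC.ext J ↔ e d ∈ I.inner := by
  simpa [innerC, ALCOu.Concept.ext] using h.inner d

theorem mem_ext_nomOf {τ : ALCOStar.Term} (h : NameCorrect J I e τ) (d : J.Dom) :
    d ∈ (nomOf τ).ext J ↔ e d = τ.val I := by
  simp only [nomOf, ALCOu.Concept.ext, ALCOu.Term.val, Set.mem_ofPred_eq]
  rw [h, Option.some_inj, eq_comm, Equiv.eq_symm_apply]

theorem mem_ext_trConcept (h : Represents J I e) (C : ALCOStar.Concept)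
    (hC : ∀ τ ∈ C.terms, NameCorrect J I e τ) (d : J.Dom) :
    d ∈ (trConcept C).ext J ↔ e d ∈ C.ext I := by
  match C with
  | .atom A => simpa [trConcept, ALCOu.Concept.ext, ALCOStar.Concept.ext] using h.con A d
  | .existing => simpa [trConcept, ALCOStar.Concept.ext] using mem_ext_innerC h d
  | .nom τ =>
    rw [trConcept, mem_ext_nomOf (hC τ (by simpa [ALCOStar.Concept.terms] using τ.self_mem_terms))]
    simp [ALCOStar.Concept.ext]
  | .neg C =>
    have := mem_ext_trConcept h C (by simpa [ALCOStar.Concept.terms] using hC) d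
    simp [trConcept, ALCOu.Concept.ext, ALCOStar.Concept.ext, this]
  | .conj C D =>
    simp only [ALCOStar.Concept.terms, List.mem_append] at hC
    have h1 := mem_ext_trConcept h C (fun τ hτ => hC τ (.inl hτ)) d
    have h2 := mem_ext_trConcept h D (fun τ hτ => hC τ (.inr hτ)) d
    simp [trConcept, ALCOu.Concept.ext, ALCOStar.Concept.ext, h1, h2]
  | .ex r C =>
    have ih := mem_ext_trConcept h C (by simpa [ALCOStar.Concept.terms] using hC)
    simp only [trConcept, ALCOu.Concept.ext, ALCOStar.Concept.ext, Set.mem_ofPred_eq,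
      Set.mem_inter_iff, mem_ext_innerC h, ih, h.role]
    exact ⟨fun ⟨x, hx⟩ => ⟨e x, hx⟩, fun ⟨x, hx⟩ => ⟨e.symm x, by simpa using hx⟩⟩

/-- Correctness is assumed only for the names of terms inside `C`, not for the name of `ιC` itself.
This lets the values of names be determined by induction on terms. -/
theorem sat_defAxm_iota (h : Represents J I e) (C : ALCOStar.Concept)
    (hC : ∀ τ ∈ C.terms, NameCorrect J I e τ) :
    (defAxm (.iota C)).Sat J ↔ ∃ d, J.ind (nameOf (.iota C)) = some d ∧
      (I.inner ∩ C.ext I = {e d} ∨ e d ∉ I.inner ∧ ∀ x, I.inner ∩ C.ext I ≠ {x}) := by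
  have hS : ∀ x, (conj innerC (trConcept C)).ext J = {x} ↔ I.inner ∩ C.ext I = {e x} := by
    intro x
    have hpre : (conj innerC (trConcept C)).ext J = e ⁻¹' (I.inner ∩ C.ext I) := by
      ext y
      simp [ALCOu.Concept.ext, mem_ext_innerC h, mem_ext_trConcept h C hC]
    rw [hpre, ← Set.image_eq_image e.injective, Set.image_preimage_eq _ e.surjective,
      Set.image_singleton]
  simp only [defAxm, ALCOu.Axm.Sat, ALCOu.Term.val, ALCOu.Concept.ext]
  refine exists_congr fun d => and_congr_right fun hd => ?_
  rw [Set.mem_ofPred_eq, uniqueElem_eq_some]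
  -- The range of the outer description, once the name denotes `d`: the unique existing instance of
  -- `C`, if any, together with `d` if `d` does not exist.
  have hY : ∀ y, y ∈ ({y | uniqueElem (innerC.ext J ∩ (trConcept C).ext J) = some y}ᶜ ∩
      ((nomOf (.iota C)).ext J ∩ (innerC.ext J)ᶜ)ᶜ)ᶜ ↔
      I.inner ∩ C.ext I = {e y} ∨ y = d ∧ e y ∉ I.inner := by
    intro y
    have h1 : uniqueElem (innerC.ext J ∩ (trConcept C).ext J) = some y ↔
        I.inner ∩ C.ext I = {e y} := by
      rw [uniqueElem_eq_some]; exact hS y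
    have h2 : y ∈ (nomOf (.iota C)).ext J ↔ y = d := by
      simp only [nomOf, ALCOu.Concept.ext, ALCOu.Term.val, Set.mem_ofPred_eq, hd,
        Option.some_inj]
      exact eq_comm
    rw [Set.compl_inter, compl_compl, compl_compl, Set.mem_union, Set.mem_ofPred_eq, h1,
      Set.mem_inter_iff, Set.mem_compl_iff, mem_ext_innerC h, h2]
  have hinner : ∀ y, I.inner ∩ C.ext I = {e y} → e y ∈ I.inner := fun y hy =>
    (hy.symm.subset rfl).1
  have hinj : ∀ y z, I.inner ∩ C.ext I = {e y} → I.inner ∩ C.ext I = {e z} → y = z :=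
    fun y z hy hz => e.injective (Set.singleton_eq_singleton_iff.1 (hy.symm.trans hz))
  rw [Set.ext_iff]
  simp only [hY, Set.mem_singleton_iff]
  constructor
  · intro H
    rcases (H d).2 rfl with h1 | h1
    · exact .inl h1
    · refine .inr ⟨h1.2, fun x hx => ?_⟩
      have hx' : I.inner ∩ C.ext I = {e (e.symm x)} := by simpa using hx
      have hxd := (H _).1 (.inl hx')
      -- A unique existing instance would also lie in the union, hence equal `d`, which is not in
      -- the inner domain.
      exact h1.2 (hxd ▸ hinner _ hx')
  · rintro (H | H) y
    · constructor
      · rintro (h1 | h1)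
        · exact hinj _ _ h1 H
        · exact h1.1
      · rintro rfl
        exact .inl H
    · constructor
      · rintro (h1 | h1)
        · exact (H.2 _ h1).elim
        · exact h1.1
      · rintro rfl
        exact .inr ⟨rfl, H.1⟩

/-- The truth of an axiom under the semantics given by the flag. -/
def SatAxm (negative : Bool) (I : ALCOStar.Interp) (β : ALCOStar.Axm) : Prop :=
  if negative then β.SatNeg I else β.SatPos I

/-- The truth of a formula under the semantics given by the flag. -/
def SatFormula (negative : Bool) (I : ALCOStar.Interp) (φ : ALCOStar.Formula) : Prop :=
  if negative then φ.SatNeg I else φ.SatPos I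

theorem mem_ext_guard (h : Represents J I e) (negative : Bool) (C : ALCOu.Concept) (d : J.Dom) :
    d ∈ (guard negative C).ext J ↔ (negative = true → e d ∈ I.inner) ∧ d ∈ C.ext J := by
  cases negative <;> simp [guard, ALCOu.Concept.ext, mem_ext_innerC h]

theorem mem_ext_trAxm (h : Represents J I e) (negative : Bool) (β : ALCOStar.Axm)
    (hβ : ∀ τ ∈ β.terms, NameCorrect J I e τ) (d : J.Dom) :
    d ∈ (trAxm negative β).ext J ↔ SatAxm negative I β := by
  cases β with
  | sub C D =>
    simp only [ALCOStar.Axm.terms, List.mem_append] at hβ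
    have h1 := mem_ext_trConcept h C fun τ hτ => hβ τ (.inl hτ)
    have h2 := mem_ext_trConcept h D fun τ hτ => hβ τ (.inr hτ)
    have : SatAxm negative I (.sub C D) ↔ ∀ d ∈ I.inner, d ∈ C.ext I → d ∈ D.ext I := by
      cases negative <;> rfl
    rw [this]
    simp only [trAxm, ALCOu.Concept.ext, mem_ext_innerC h, h1, h2, Set.mem_compl_iff,
      Set.mem_ofPred_eq, Set.mem_inter_iff, not_exists, not_and, not_not]
    constructor
    · intro H x
      simpa using H (e.symm x)
    · intro H x
      exact H (e x)
  | inst C τ =>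
    simp only [ALCOStar.Axm.terms, List.mem_append] at hβ
    have h1 := mem_ext_trConcept h C fun τ hτ => hβ τ (.inl hτ)
    have h2 := mem_ext_nomOf (hβ τ (.inr τ.self_mem_terms))
    simp only [trAxm, ALCOu.Concept.ext, Set.mem_ofPred_eq, mem_ext_guard h, Set.mem_inter_iff,
      h1, h2]
    rw [e.exists_congr_left]
    cases negative <;> simp [SatAxm, ALCOStar.Axm.SatPos, ALCOStar.Axm.SatNeg]
  | rel r τ₁ τ₂ =>
    simp only [ALCOStar.Axm.terms, List.mem_append] at hβ
    have h1 := mem_ext_nomOf (hβ τ₁ (.inl τ₁.self_mem_terms))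
    have h2 := mem_ext_nomOf (hβ τ₂ (.inr τ₂.self_mem_terms))
    simp only [trAxm, ALCOu.Concept.ext, Set.mem_ofPred_eq, mem_ext_guard h, Set.mem_inter_iff,
      h1, h2, h.role]
    simp only [e.exists_congr_left, Equiv.apply_symm_apply]
    cases negative <;> simp [SatAxm, ALCOStar.Axm.SatPos, ALCOStar.Axm.SatNeg]
  | eq τ₁ τ₂ =>
    simp only [ALCOStar.Axm.terms, List.mem_append] at hβ
    have h1 := mem_ext_nomOf (hβ τ₁ (.inl τ₁.self_mem_terms))
    have h2 := mem_ext_nomOf (hβ τ₂ (.inr τ₂.self_mem_terms))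
    simp only [trAxm, ALCOu.Concept.ext, Set.mem_ofPred_eq, mem_ext_guard h, Set.mem_inter_iff,
      h1, h2]
    simp only [e.exists_congr_left, Equiv.apply_symm_apply]
    cases negative <;> simp [SatAxm, ALCOStar.Axm.SatPos, ALCOStar.Axm.SatNeg]; grind

/-- The right-hand side does not mention `d`: complement and intersection of concepts that are empty
or universal behave like negation and conjunction of truth values. -/
theorem mem_ext_trFormula (h : Represents J I e) (negative : Bool) (φ : ALCOStar.Formula)
    (hφ : ∀ τ ∈ φ.terms, NameCorrect J I e τ) (d : J.Dom) :
    d ∈ (trFormula negative φ).ext J ↔ SatFormula negative I φ := by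
  induction φ with
  | ax β =>
    rw [trFormula, mem_ext_trAxm h negative β hφ]
    cases negative <;> rfl
  | neg φ ih =>
    rw [trFormula, ALCOu.Concept.ext, Set.mem_compl_iff, ih hφ]
    cases negative <;> rfl
  | and φ ψ ih ih' =>
    simp only [ALCOStar.Formula.terms, List.mem_append] at hφ
    rw [trFormula, ALCOu.Concept.ext, Set.mem_inter_iff, ih fun τ hτ => hφ τ (.inl hτ),
      ih' fun τ hτ => hφ τ (.inr hτ)]
    cases negative <;> rfl

end

-- Passing between partial and dual-domain interpretations.

open Classical in
/-- The partial interpretation that represents a dual-domain interpretation. -/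
noncomputable def toPartial (I : ALCOStar.Interp) : ALCOu.Interp where
  Dom := I.Dom
  nonempty := I.nonempty
  con
    | [] => I.inner
    | _ :: A => I.con A
  role r := I.role r.reverse
  ind a := if h : ∃ τ, nameOf τ = a then some (h.choose.val I) else none

theorem represents_toPartial (I : ALCOStar.Interp) :
    Represents (toPartial I) I (Equiv.refl I.Dom) where
  inner _ := Iff.rfl
  con _ _ := Iff.rfl
  role r d d' := by simp only [toPartial, List.reverse_reverse]; rfl

theorem nameCorrect_toPartial (I : ALCOStar.Interp) (τ : ALCOStar.Term) :
    NameCorrect (toPartial I) I (Equiv.refl I.Dom) τ := by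
  have h : ∃ σ, nameOf σ = nameOf τ := ⟨τ, rfl⟩
  -- Distinct terms have distinct names, so the value given to a name is unambiguous.
  have h' : h.choose = τ := nameOf_injective h.choose_spec
  simp only [NameCorrect, toPartial, dif_pos h, h', Equiv.refl_symm]
  rfl

theorem sat_defAxm_toPartial (I : ALCOStar.Interp) (τ : ALCOStar.Term) :
    (defAxm τ).Sat (toPartial I) := by
  cases τ with
  | ind a =>
    exact ⟨_, nameCorrect_toPartial I (.ind a), by rw [ext_topC]; trivial⟩
  | iota C =>
    rw [sat_defAxm_iota (represents_toPartial I) C fun τ _ => nameCorrect_toPartial I τ]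
    refine ⟨_, nameCorrect_toPartial I (.iota C), ?_⟩
    simp only [ALCOStar.Term.val]
    cases h : uniqueElem (I.inner ∩ C.ext I) with
    | none =>
      refine .inr ⟨I.descr_notMem C, fun x hx => ?_⟩
      rw [← uniqueElem_eq_some, h] at hx
      cases hx
    | some d => exact .inl (uniqueElem_eq_some.1 h)

open Classical in
/-- The dual-domain interpretation that is represented by a partial interpretation in which `o`
does not belong to the inner domain. -/
noncomputable def toDual (J : ALCOu.Interp) (o : J.Dom) (ho : o ∉ J.con []) :
    ALCOStar.Interp where
  Dom := J.Dom
  nonempty := J.nonempty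
  inner := J.con []
  inner_ssubset := Set.ssubset_univ_iff.2 fun h => ho (h ▸ Set.mem_univ o)
  con A := J.con (true :: A)
  role r := J.role r.reverse
  ind a := (J.ind (nameOf (.ind a))).getD o
  descr C :=
    -- The fallback `o` keeps the value outside the inner domain. It is never used for a failing
    -- description whose defining axiom and those of its subterms hold, since its name then denotes
    -- outside the inner domain.
    if (J.ind (nameOf (.iota C))).getD o ∈ J.con [] then o
    else (J.ind (nameOf (.iota C))).getD o
  descr_notMem C := by split_ifs with h <;> assumption

theorem represents_toDual (J : ALCOu.Interp) (o : J.Dom) (ho : o ∉ J.con []) :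
    Represents J (toDual J o ho) (Equiv.refl J.Dom) where
  inner _ := Iff.rfl
  con _ _ := Iff.rfl
  role _ _ _ := Iff.rfl

section

variable {J : ALCOu.Interp} {o : J.Dom} {ho : o ∉ J.con []}

mutual
-- Induction from the inside out: once the names inside `C` are correct, `C` has the intended
-- extension, and the axiom for `ιC` settles its own name. If the description fails, `descr` was
-- defined as the value of that name.
theorem ALCOStar.Term.nameCorrect_toDual : ∀ τ : ALCOStar.Term,
    (∀ σ ∈ τ.terms, (defAxm σ).Sat J) →
      ∀ σ ∈ τ.terms, NameCorrect J (toDual J o ho) (Equiv.refl J.Dom) σ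
  | .ind a, h => by
    intro σ hσ
    obtain rfl : σ = .ind a := by simpa [ALCOStar.Term.terms] using hσ
    obtain ⟨d, hd, -⟩ := h _ hσ
    simp only [ALCOu.Term.val] at hd
    simp [NameCorrect, ALCOStar.Term.val, toDual, hd]
    rfl
  | .iota C, h => by
    simp only [ALCOStar.Term.terms, List.mem_cons, forall_eq_or_imp] at h ⊢
    have hC := ALCOStar.Concept.nameCorrect_toDual C h.2
    refine ⟨?_, hC⟩
    obtain ⟨d, hd, hd'⟩ := (sat_defAxm_iota (represents_toDual J o ho) C hC).1 h.1
    rcases hd' with hd' | ⟨hd1, hd2⟩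
    · rw [← uniqueElem_eq_some] at hd'
      simp only [NameCorrect, ALCOStar.Term.val, hd', hd, Option.getD_some]
      rfl
    · have hn : uniqueElem ((toDual J o ho).inner ∩ C.ext (toDual J o ho)) = none := by
        rw [Option.eq_none_iff_forall_ne_some]
        intro x hx
        exact hd2 x (uniqueElem_eq_some.1 hx)
      have hd1' : d ∉ J.con [] := hd1
      simp only [NameCorrect, ALCOStar.Term.val, hn, Option.getD_none]
      simp [toDual, hd, hd1']
      rfl
theorem ALCOStar.Concept.nameCorrect_toDual : ∀ C : ALCOStar.Concept,
    (∀ σ ∈ C.terms, (defAxm σ).Sat J) →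
      ∀ σ ∈ C.terms, NameCorrect J (toDual J o ho) (Equiv.refl J.Dom) σ
  | .atom A, _ => by simp [ALCOStar.Concept.terms]
  | .existing, _ => by simp [ALCOStar.Concept.terms]
  | .nom τ, h => by
    simpa only [ALCOStar.Concept.terms] using ALCOStar.Term.nameCorrect_toDual τ h
  | .neg C, h => by
    simpa only [ALCOStar.Concept.terms] using ALCOStar.Concept.nameCorrect_toDual C h
  | .conj C D, h => by
    simp only [ALCOStar.Concept.terms, List.mem_append, or_imp, forall_and] at h ⊢
    exact ⟨ALCOStar.Concept.nameCorrect_toDual C h.1, ALCOStar.Concept.nameCorrect_toDual D h.2⟩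
  | .ex r C, h => by
    simpa only [ALCOStar.Concept.terms] using ALCOStar.Concept.nameCorrect_toDual C h
end

theorem ALCOStar.Formula.nameCorrect_toDual (φ : ALCOStar.Formula)
    (h : ∀ σ ∈ φ.terms, (defAxm σ).Sat J) :
    ∀ σ ∈ φ.terms, NameCorrect J (toDual J o ho) (Equiv.refl J.Dom) σ := by
  induction φ with
  | ax β =>
    cases β <;> simp only [ALCOStar.Formula.terms, ALCOStar.Axm.terms, List.mem_append, or_imp,
      forall_and] at h ⊢ <;>
    first
      | exact ⟨ALCOStar.Concept.nameCorrect_toDual _ h.1,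
          ALCOStar.Concept.nameCorrect_toDual _ h.2⟩
      | exact ⟨ALCOStar.Concept.nameCorrect_toDual _ h.1,
          ALCOStar.Term.nameCorrect_toDual _ h.2⟩
      | exact ⟨ALCOStar.Term.nameCorrect_toDual _ h.1,
          ALCOStar.Term.nameCorrect_toDual _ h.2⟩
  | neg φ ih => exact ih h
  | and φ ψ ih ih' =>
    simp only [ALCOStar.Formula.terms, List.mem_append, or_imp, forall_and] at h ⊢
    exact ⟨ih h.1, ih' h.2⟩

end

theorem exists_satFormula_iff (negative : Bool) (φ : ALCOStar.Formula) :
    (∃ I, SatFormula negative I φ) ↔ (reduction negative φ).Satisfiable := by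
  constructor
  · rintro ⟨I, hI⟩
    refine ⟨toPartial I, ?_⟩
    simp only [reduction, List.mem_cons, List.mem_map, forall_eq_or_imp]
    refine ⟨fun d _ => ⟨?_, ?_⟩, ?_⟩
    · obtain ⟨o, -, ho⟩ := Set.exists_of_ssubset I.inner_ssubset
      exact ⟨o, fun h => ho ((mem_ext_innerC (represents_toPartial I) o).1 h)⟩
    · exact (mem_ext_trFormula (represents_toPartial I) negative φ
        (fun τ _ => nameCorrect_toPartial I τ) d).2 hI
    · rintro α ⟨τ, -, rfl⟩
      exact sat_defAxm_toPartial I τ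
  · rintro ⟨J, hJ⟩
    simp only [reduction, List.mem_cons, List.mem_map, forall_eq_or_imp] at hJ
    obtain ⟨d⟩ := J.nonempty
    -- Any element serves as `d`: the inclusion applied to it yields a witness `o` outside the inner
    -- domain and the truth of the formula.
    obtain ⟨⟨o, ho⟩, hd⟩ := hJ.1 (show d ∈ topC.ext J by rw [ext_topC]; trivial)
    have ho' : o ∉ J.con [] := ho
    exact ⟨toDual J o ho', (mem_ext_trFormula (represents_toDual J o ho') negative φ
      (φ.nameCorrect_toDual fun σ hσ => hJ.2 _ ⟨σ, hσ, rfl⟩) d).1 hd⟩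

/-! ### A task machine for the reduction -/

/-- The data stacks: input, symbols already read, auxiliary stack (and output), reversed output. -/
inductive Stk : Type
  | inp
  | tmp
  | aux
  | out
  deriving DecidableEq

instance : Fintype Stk := ⟨{.inp, .tmp, .aux, .out}, fun k => by cases k <;> decide⟩

/-- The tasks. -/
inductive Job : Type
  /-- write a symbol -/
  | emit (s : Sym)
  | start
  /-- translate a formula -/
  | form
  /-- translate a concept -/
  | conc
  /-- write the nominal that stands for a term -/
  | nomTerm
  /-- copy a name -/
  | copyName
  /-- move a name to the auxiliary stack -/
  | loadName
  /-- write the name on the auxiliary stack -/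
  | flushName
  /-- pass over a symbol -/
  | skip
  /-- write the code of a term -/
  | codeTerm
  /-- write the code of a concept -/
  | codeConc
  /-- write the code of a name -/
  | codeName
  /-- write the code of a symbol -/
  | codeSym
  /-- put back all symbols read -/
  | restore
  /-- write the axioms for all terms in the input -/
  | scan
  /-- delete a symbol -/
  | drop
  /-- reverse the output -/
  | rev
  deriving Fintype

/-- The word of the guard. -/
def guardWord (negative : Bool) : List Sym :=
  if negative then [.conj, .atom, .endName] else []

/-- The pushes that write a word. -/
def write (w : List Sym) : List (Stk × Sym) := w.map fun s => (.out, s)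

/-- The pushes that write the code of a symbol. -/
def writeCode (s : Sym) : List (Stk × Sym) := write (s.code.map .bit)

open Job in
/-- The stack read by a task. -/
@[simp]
def taskSrc : Job → Option Stk
  | emit _ | start | nomTerm => none
  | flushName => some .aux
  | restore => some .tmp
  | rev => some .out
  | form | conc | copyName | loadName | skip | codeTerm | codeConc | codeName | codeSym | scan
  | drop => some .inp

open Job in
/-- The action of a task. -/
@[simp]
def taskAct (negative : Bool) : Job → Option Sym → List (Stk × Sym) × List Job
  | emit s, _ => (write [s], [])
  | start, _ =>
    (write [.sub, .neg, .conj, .atom, .endName, .neg, .atom, .endName, .comma, .conj, .exU, .neg,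
      .atom, .endName], [form, restore, scan, rev])
  | form, some .fneg => ((.tmp, .fneg) :: write [.neg], [form])
  | form, some .fand => ((.tmp, .fand) :: write [.conj], [form, form])
  | form, some .sub =>
    ((.tmp, .sub) :: write [.neg, .exU, .conj, .atom, .endName, .conj],
      [conc, skip, emit .neg, conc])
  | form, some .inst =>
    ((.tmp, .inst) :: write (.exU :: (guardWord negative ++ [.conj])), [conc, nomTerm])
  | form, some .rel =>
    ((.tmp, .rel) :: write (.exU :: (guardWord negative ++ [.conj])),
      -- In the input the role name precedes the first term, in the output it follows it; hence the
      -- buffering.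
      [loadName, nomTerm, emit .ex, flushName] ++ (guardWord negative).map emit ++ [nomTerm])
  | form, some .eq =>
    ((.tmp, .eq) :: write (.exU :: (guardWord negative ++ [.conj])), [nomTerm, nomTerm])
  | conc, some .atom => ((.tmp, .atom) :: write [.atom, .bit true], [copyName])
  | conc, some .existing => ((.tmp, .existing) :: write [.atom, .endName], [])
  | conc, some .nom => ([(.tmp, .nom)], [nomTerm])
  | conc, some .neg => ((.tmp, .neg) :: write [.neg], [conc])
  | conc, some .conj => ((.tmp, .conj) :: write [.conj], [conc, conc])
  | conc, some .ex =>
    ((.tmp, .ex) :: write [.ex],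
      [loadName, flushName, emit .conj, emit .atom, emit .endName, conc])
  | nomTerm, _ => (write [.nom, .ind], [codeTerm, emit .endName])
  | copyName, some (.bit b) => ((.tmp, .bit b) :: write [.bit b], [copyName])
  | copyName, some s => ((.tmp, s) :: write [s], [])
  | loadName, some (.bit b) => ([(.tmp, .bit b), (.aux, .bit b)], [loadName])
  | loadName, some s => ([(.tmp, s)], [])
  | flushName, some s => (write [s], [flushName])
  | flushName, none => (write [.endName], [])
  | skip, some s => ([(.tmp, s)], [])
  | codeTerm, some .ind => ((.tmp, .ind) :: writeCode .ind, [codeName])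
  | codeTerm, some .iota => ((.tmp, .iota) :: writeCode .iota, [codeConc, codeSym])
  | codeConc, some .atom => ((.tmp, .atom) :: writeCode .atom, [codeName])
  | codeConc, some .existing => ((.tmp, .existing) :: writeCode .existing, [])
  | codeConc, some .nom => ((.tmp, .nom) :: writeCode .nom, [codeTerm])
  | codeConc, some .neg => ((.tmp, .neg) :: writeCode .neg, [codeConc])
  | codeConc, some .conj => ((.tmp, .conj) :: writeCode .conj, [codeConc, codeConc])
  | codeConc, some .ex => ((.tmp, .ex) :: writeCode .ex, [codeName, codeConc])
  | codeName, some (.bit b) => ((.tmp, .bit b) :: writeCode (.bit b), [codeName])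
  | codeName, some s => ((.tmp, s) :: writeCode s, [])
  | codeSym, some s => ((.tmp, s) :: writeCode s, [])
  | restore, some s => ([(.inp, s)], [restore])
  -- The symbols `.ind` and `.iota` occur only at the start of a term. The symbol is put back so
  -- that the whole term can be read, the input is restored, and then only this symbol is deleted,
  -- so nested terms are still met.
  | scan, some .ind =>
    ((.inp, .ind) :: write [.inst, .neg, .conj, .atom, .endName, .neg, .atom, .endName, .ind],
      [codeTerm, emit .endName, restore, drop, scan])
  | scan, some .iota =>
    ((.inp, .iota) :: write [.inst, .nom, .iota, .neg, .conj, .neg, .nom, .iota, .conj, .atom,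
        .endName],
      [skip, conc, restore, emit .close, emit .neg, emit .conj, nomTerm, restore, emit .neg,
        emit .atom, emit .endName, emit .close, emit .ind, codeTerm, emit .endName, restore, drop,
        scan])
  | scan, some _ => ([], [scan])
  | rev, some s => ([(.aux, s)], [rev])
  | _, _ => ([], [])

/-- The task machine for the reduction. -/
def machine (negative : Bool) : TaskMachine Stk Job Sym where
  src := taskSrc
  act := taskAct negative
  start := .start
  input := .inp
  output := .aux

@[simp] theorem machine_src (negative : Bool) : (machine negative).src = taskSrc := rfl

@[simp] theorem machine_act (negative : Bool) : (machine negative).act = taskAct negative := rfl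

/-- The stacks with the given contents. -/
@[simp]
def st (i m a o : List Sym) : Stk → List Sym
  | .inp => i
  | .tmp => m
  | .aux => a
  | .out => o

section

variable (i m a o x : List Sym)

@[simp] theorem update_st_inp : Function.update (st i m a o) .inp x = st x m a o := by
  funext k; cases k <;> rfl

@[simp] theorem update_st_tmp : Function.update (st i m a o) .tmp x = st i x a o := by
  funext k; cases k <;> rfl

@[simp] theorem update_st_aux : Function.update (st i m a o) .aux x = st i m x o := by
  funext k; cases k <;> rfl

@[simp] theorem update_st_out : Function.update (st i m a o) .out x = st i m a x := by
  funext k; cases k <;> rfl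

open TaskMachine (pushes)

@[simp] theorem pushes_write (w : List Sym) :
    pushes (write w) (st i m a o) = st i m a (w.reverse ++ o) := by
  induction w generalizing o with
  | nil => rfl
  | cons s w ih =>
    have : pushes (write (s :: w)) (st i m a o) =
        pushes (write w) (Function.update (st i m a o) .out (s :: o)) := rfl
    rw [this, update_st_out, ih]
    simp

@[simp] theorem pushes_inp (s : Sym) (l : List (Stk × Sym)) :
    pushes ((.inp, s) :: l) (st i m a o) = pushes l (st (s :: i) m a o) :=
  congrArg (pushes l) (update_st_inp ..)

@[simp] theorem pushes_tmp (s : Sym) (l : List (Stk × Sym)) :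
    pushes ((.tmp, s) :: l) (st i m a o) = pushes l (st i (s :: m) a o) :=
  congrArg (pushes l) (update_st_tmp ..)

@[simp] theorem pushes_aux (s : Sym) (l : List (Stk × Sym)) :
    pushes ((.aux, s) :: l) (st i m a o) = pushes l (st i m (s :: a) o) :=
  congrArg (pushes l) (update_st_aux ..)

@[simp] theorem pushes_nil : pushes [] (st i m a o) = st i m a o := rfl

end

theorem TaskMachine.Reach.step_le {D T S : Type} [DecidableEq D] {M : TaskMachine D T S}
    {n k : ℕ} {t : T} {c c' : List T} {f f' : D → List S}
    (h : M.Reach n ((M.act t (popSym f (M.src t))).2 ++ c)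
      (pushes (M.act t (popSym f (M.src t))).1 (popStk f (M.src t))) c' f')
    (hk : n + 1 ≤ k) : M.Reach k (t :: c) f c' f' :=
  (Reach.step h).mono hk

/-- The word for the code of a word. -/
def codeWord (w : List Sym) : List Sym := (w.flatMap Sym.code).map .bit

attribute [simp] TaskMachine.popSym TaskMachine.popStk

@[simp] theorem codeWord_cons (s : Sym) (w : List Sym) :
    codeWord (s :: w) = s.code.map .bit ++ codeWord w := by simp [codeWord]

@[simp] theorem codeWord_append (v w : List Sym) : codeWord (v ++ w) = codeWord v ++ codeWord w := by
  simp [codeWord]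

@[simp] theorem enc_nomOf (τ : ALCOStar.Term) :
    (nomOf τ).enc = .nom :: .ind :: (codeWord τ.enc ++ [.endName]) := rfl

@[simp] theorem encName_cons (b : Bool) (r : Name) : encName (b :: r) = .bit b :: encName r := rfl

@[simp] theorem encName_nil : encName [] = [.endName] := rfl

-- Runs of the tasks on names and single symbols.

section

variable (negative : Bool) (c : List Job) (i m a o : List Sym)

open Job

local notation "R" => TaskMachine.Reach (machine negative)

theorem reach_emits (w : List Sym) :
    R w.length (w.map emit ++ c) (st i m a o) c (st i m a (w.reverse ++ o)) := by
  induction w generalizing o with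
  | nil => exact .refl _ _ _
  | cons s w ih =>
    apply TaskMachine.Reach.step_le
    · simpa using ih (s :: o)
    · simp

theorem reach_copyName (r : Name) (v : List Sym) :
    R (encName r).length (copyName :: c) (st (encName r ++ v) m a o) c
      (st v ((encName r).reverse ++ m) a ((encName r).reverse ++ o)) := by
  induction r generalizing m o with
  | nil =>
    apply TaskMachine.Reach.step_le
    · simpa using .refl 0 _ _
    · simp
  | cons b r ih =>
    apply TaskMachine.Reach.step_le
    · simpa using ih (.bit b :: m) (.bit b :: o)
    · simp

theorem reach_loadName (r : Name) (v : List Sym) :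
    R (encName r).length (loadName :: c) (st (encName r ++ v) m a o) c
      (st v ((encName r).reverse ++ m) (r.reverse.map .bit ++ a) o) := by
  induction r generalizing m a with
  | nil =>
    apply TaskMachine.Reach.step_le
    · simpa using .refl 0 _ _
    · simp
  | cons b r ih =>
    apply TaskMachine.Reach.step_le
    · simpa using ih (.bit b :: m) (.bit b :: a)
    · simp

/-- The auxiliary stack carries no end marker: the name ends where the stack is empty. Therefore the
translation tasks below start with this stack empty. -/
theorem reach_flushName (r : Name) :
    R (encName r).length (flushName :: c) (st i m (r.map .bit) o) c
      (st i m [] ((encName r).reverse ++ o)) := by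
  induction r generalizing o with
  | nil =>
    apply TaskMachine.Reach.step_le
    · simpa using .refl 0 _ _
    · simp
  | cons b r ih =>
    apply TaskMachine.Reach.step_le
    · simpa using ih (.bit b :: o)
    · simp

theorem reach_skip (s : Sym) : R 1 (skip :: c) (st (s :: i) m a o) c (st i (s :: m) a o) := by
  apply TaskMachine.Reach.step_le
  · simpa using .refl 0 _ _
  · simp

theorem reach_codeName (r : Name) (v : List Sym) :
    R (encName r).length (codeName :: c) (st (encName r ++ v) m a o) c
      (st v ((encName r).reverse ++ m) a ((codeWord (encName r)).reverse ++ o)) := by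
  induction r generalizing m o with
  | nil =>
    apply TaskMachine.Reach.step_le
    · simpa [writeCode] using .refl 0 _ _
    · simp
  | cons b r ih =>
    apply TaskMachine.Reach.step_le
    · simpa [writeCode] using ih (.bit b :: m) (((Sym.bit b).code.map .bit).reverse ++ o)
    · simp

theorem reach_codeSym (s : Sym) :
    R 1 (codeSym :: c) (st (s :: i) m a o) c
      (st i (s :: m) a ((codeWord [s]).reverse ++ o)) := by
  apply TaskMachine.Reach.step_le
  · simpa [writeCode] using .refl 0 _ _
  · simp

theorem reach_restore :
    R (m.length + 1) (restore :: c) (st i m a o) c (st (m.reverse ++ i) [] a o) := by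
  induction m generalizing i with
  | nil =>
    apply TaskMachine.Reach.step_le
    · simpa using .refl 0 _ _
    · simp
  | cons s m ih =>
    apply TaskMachine.Reach.step_le
    · simpa using ih (s :: i)
    · simp

theorem reach_rev :
    R (o.length + 1) (rev :: c) (st i m a o) c (st i m (o.reverse ++ a) []) := by
  induction o generalizing a with
  | nil =>
    apply TaskMachine.Reach.step_le
    · simpa using .refl 0 _ _
    · simp
  | cons s m ih =>
    apply TaskMachine.Reach.step_le
    · simpa using ih (s :: a)
    · simp

end

-- Writing the codes of terms and concepts.

section

variable (negative : Bool)

open Job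

local notation "R" => TaskMachine.Reach (machine negative)

mutual
theorem reach_codeTerm : ∀ (τ : ALCOStar.Term) (c : List Job) (v m a o : List Sym),
    R τ.enc.length (codeTerm :: c) (st (τ.enc ++ v) m a o) c
      (st v (τ.enc.reverse ++ m) a ((codeWord τ.enc).reverse ++ o))
  | .ind r, c, v, m, a, o => by
    apply TaskMachine.Reach.step_le
    · simpa [writeCode, ALCOStar.Term.enc] using reach_codeName negative c _ a _ r v
    · simp [ALCOStar.Term.enc]
  | .iota C, c, v, m, a, o => by
    apply TaskMachine.Reach.step_le
    · simpa [writeCode, ALCOStar.Term.enc] using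
        (reach_codeConc C (codeSym :: c) (.close :: v) _ a _).trans
          (reach_codeSym negative c _ _ a _ .close)
    · simp [ALCOStar.Term.enc]
theorem reach_codeConc : ∀ (C : ALCOStar.Concept) (c : List Job) (v m a o : List Sym),
    R C.enc.length (codeConc :: c) (st (C.enc ++ v) m a o) c
      (st v (C.enc.reverse ++ m) a ((codeWord C.enc).reverse ++ o))
  | .atom A, c, v, m, a, o => by
    apply TaskMachine.Reach.step_le
    · simpa [writeCode, ALCOStar.Concept.enc] using reach_codeName negative c _ a _ A v
    · simp [ALCOStar.Concept.enc]
  | .existing, c, v, m, a, o => by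
    apply TaskMachine.Reach.step_le
    · simpa [writeCode, ALCOStar.Concept.enc] using .refl 0 _ _
    · simp [ALCOStar.Concept.enc]
  | .nom τ, c, v, m, a, o => by
    apply TaskMachine.Reach.step_le
    · simpa [writeCode, ALCOStar.Concept.enc] using reach_codeTerm τ c v _ a _
    · simp [ALCOStar.Concept.enc]
  | .neg C, c, v, m, a, o => by
    apply TaskMachine.Reach.step_le
    · simpa [writeCode, ALCOStar.Concept.enc] using reach_codeConc C c v _ a _
    · simp [ALCOStar.Concept.enc]
  | .conj C D, c, v, m, a, o => by
    apply TaskMachine.Reach.step_le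
    · simpa [writeCode, ALCOStar.Concept.enc] using
        (reach_codeConc C (codeConc :: c) (D.enc ++ v) _ a _).trans (reach_codeConc D c v _ a _)
    · simp [ALCOStar.Concept.enc]
  | .ex r C, c, v, m, a, o => by
    apply TaskMachine.Reach.step_le
    · simpa [writeCode, ALCOStar.Concept.enc] using
        (reach_codeName negative (codeConc :: c) _ a _ r (C.enc ++ v)).trans
          (reach_codeConc C c v _ a _)
    · simp [ALCOStar.Concept.enc]
end

end

theorem length_encName (r : Name) : (encName r).length = r.length + 1 := by simp [encName]

@[simp] theorem enc_innerC : innerC.enc = [.atom, .endName] := rfl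

@[simp] theorem enc_topC :
    topC.enc = [.neg, .conj, .atom, .endName, .neg, .atom, .endName] := rfl

@[simp] theorem enc_guard (negative : Bool) (C : ALCOu.Concept) :
    (guard negative C).enc = guardWord negative ++ C.enc := by
  cases negative <;> simp [guard, guardWord, ALCOu.Concept.enc]

@[simp] theorem encName_nameOf (τ : ALCOStar.Term) :
    encName (nameOf τ) = codeWord τ.enc ++ [.endName] := rfl

@[simp] theorem enc_ind_nameOf (τ : ALCOStar.Term) :
    (ALCOu.Term.ind (nameOf τ)).enc = .ind :: (codeWord τ.enc ++ [.endName]) := rfl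

theorem length_guardWord (negative : Bool) : (guardWord negative).length ≤ 3 := by
  cases negative <;> simp [guardWord]

-- Translating concepts and formulas, and scanning for terms.

section

variable (negative : Bool)

open Job

local notation "R" => TaskMachine.Reach (machine negative)

theorem reach_nomTerm (τ : ALCOStar.Term) (c : List Job) (v m a o : List Sym) :
    R (τ.enc.length + 2) (nomTerm :: c) (st (τ.enc ++ v) m a o) c
      (st v (τ.enc.reverse ++ m) a ((nomOf τ).enc.reverse ++ o)) := by
  apply TaskMachine.Reach.step_le
  · simpa using (reach_codeTerm negative τ (emit .endName :: c) v m a _).trans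
      (reach_emits negative c _ _ a _ [.endName])
  · simp

theorem reach_conc : ∀ (C : ALCOStar.Concept) (c : List Job) (v m o : List Sym),
    R (4 * C.enc.length) (conc :: c) (st (C.enc ++ v) m [] o) c
      (st v (C.enc.reverse ++ m) [] ((trConcept C).enc.reverse ++ o))
  | .atom A, c, v, m, o => by
    apply TaskMachine.Reach.step_le
    · simpa [ALCOStar.Concept.enc, ALCOu.Concept.enc, trConcept] using
        reach_copyName negative c _ [] _ A v
    · simp only [ALCOStar.Concept.enc, List.length_cons]; omega
  | .existing, c, v, m, o => by
    apply TaskMachine.Reach.step_le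
    · simpa [ALCOStar.Concept.enc, ALCOu.Concept.enc, trConcept] using .refl 0 _ _
    · simp [ALCOStar.Concept.enc]
  | .nom τ, c, v, m, o => by
    apply TaskMachine.Reach.step_le
    · simpa [ALCOStar.Concept.enc, trConcept] using reach_nomTerm negative τ c v _ [] _
    · simp only [ALCOStar.Concept.enc, List.length_cons]; omega
  | .neg C, c, v, m, o => by
    apply TaskMachine.Reach.step_le
    · simpa [ALCOStar.Concept.enc, ALCOu.Concept.enc, trConcept] using reach_conc C c v _ _
    · simp only [ALCOStar.Concept.enc, List.length_cons]; omega
  | .conj C D, c, v, m, o => by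
    apply TaskMachine.Reach.step_le
    · simpa [ALCOStar.Concept.enc, ALCOu.Concept.enc, trConcept] using
        (reach_conc C (conc :: c) (D.enc ++ v) _ _).trans (reach_conc D c v _ _)
    · simp only [ALCOStar.Concept.enc, List.length_cons, List.length_append]; omega
  | .ex r C, c, v, m, o => by
    apply TaskMachine.Reach.step_le
    · simpa [ALCOStar.Concept.enc, ALCOu.Concept.enc, trConcept] using
        (reach_loadName negative
          (flushName :: emit .conj :: emit .atom :: emit .endName :: conc :: c) _ [] _ r
          (C.enc ++ v)).trans <|
        -- The buffer holds the bits of `r` in reverse order, so the word written is that of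
        -- `r.reverse`.
        .trans (by simpa using reach_flushName negative _ _ _ _ r.reverse) <|
        (reach_emits negative (conc :: c) _ _ [] _ [.conj, .atom, .endName]).trans
          (reach_conc C c v _ _)
    · simp [ALCOStar.Concept.enc, length_encName]; omega

theorem reach_form : ∀ (φ : ALCOStar.Formula) (c : List Job) (v m o : List Sym),
    R (8 * φ.enc.length) (form :: c) (st (φ.enc ++ v) m [] o) c
      (st v (φ.enc.reverse ++ m) [] ((trFormula negative φ).enc.reverse ++ o))
  | .neg φ, c, v, m, o => by
    apply TaskMachine.Reach.step_le
    · simpa [ALCOStar.Formula.enc, ALCOu.Concept.enc, trFormula] using reach_form φ c v _ _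
    · simp only [ALCOStar.Formula.enc, List.length_cons]; omega
  | .and φ ψ, c, v, m, o => by
    apply TaskMachine.Reach.step_le
    · simpa [ALCOStar.Formula.enc, ALCOu.Concept.enc, trFormula] using
        (reach_form φ (form :: c) (ψ.enc ++ v) _ _).trans (reach_form ψ c v _ _)
    · simp only [ALCOStar.Formula.enc, List.length_cons, List.length_append]; omega
  | .ax (.sub C D), c, v, m, o => by
    apply TaskMachine.Reach.step_le
    · simpa [ALCOStar.Formula.enc, ALCOStar.Axm.enc, ALCOu.Concept.enc, trFormula, trAxm] using
        (reach_conc negative C (skip :: emit .neg :: conc :: c) (.comma :: (D.enc ++ v)) _ _).trans <|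
        (reach_skip negative (emit .neg :: conc :: c) _ _ [] _ .comma).trans <|
        (reach_emits negative (conc :: c) _ _ [] _ [.neg]).trans (reach_conc negative D c v _ _)
    · simp [ALCOStar.Formula.enc, ALCOStar.Axm.enc]; omega
  | .ax (.inst C τ), c, v, m, o => by
    apply TaskMachine.Reach.step_le
    · simpa [ALCOStar.Formula.enc, ALCOStar.Axm.enc, ALCOu.Concept.enc, trFormula, trAxm] using
        (reach_conc negative C (nomTerm :: c) (τ.enc ++ v) _ _).trans
          (reach_nomTerm negative τ c v _ [] _)
    · simp [ALCOStar.Formula.enc, ALCOStar.Axm.enc]; omega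
  | .ax (.rel r τ₁ τ₂), c, v, m, o => by
    have hg := length_guardWord negative
    apply TaskMachine.Reach.step_le
    · simpa [ALCOStar.Formula.enc, ALCOStar.Axm.enc, ALCOu.Concept.enc, trFormula, trAxm] using
        (reach_loadName negative (nomTerm :: emit .ex :: flushName ::
          ((guardWord negative).map emit ++ nomTerm :: c)) _ [] _ r
          (τ₁.enc ++ (τ₂.enc ++ v))).trans <|
        (reach_nomTerm negative τ₁ _ _ _ _ _).trans <|
        (reach_emits negative (flushName ::
          ((guardWord negative).map emit ++ nomTerm :: c)) _ _ _ _ [.ex]).trans <|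
        .trans (by simpa using reach_flushName negative _ _ _ _ r.reverse) <|
        (reach_emits negative (nomTerm :: c) _ _ [] _ (guardWord negative)).trans
          (reach_nomTerm negative τ₂ c v _ [] _)
    · simp [ALCOStar.Formula.enc, ALCOStar.Axm.enc, length_encName]; omega
  | .ax (.eq τ₁ τ₂), c, v, m, o => by
    apply TaskMachine.Reach.step_le
    · simpa [ALCOStar.Formula.enc, ALCOStar.Axm.enc, ALCOu.Concept.enc, trFormula, trAxm] using
        (reach_nomTerm negative τ₁ (nomTerm :: c) (τ₂.enc ++ v) _ [] _).trans
          (reach_nomTerm negative τ₂ c v _ [] _)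
    · simp [ALCOStar.Formula.enc, ALCOStar.Axm.enc]; omega

theorem reach_scan_name (r : Name) (c : List Job) (v o : List Sym) :
    R (encName r).length (scan :: c) (st (encName r ++ v) [] [] o) (scan :: c)
      (st v [] [] o) := by
  induction r with
  | nil =>
    apply TaskMachine.Reach.step_le
    · simpa using .refl 0 _ _
    · simp
  | cons b r ih =>
    apply TaskMachine.Reach.step_le
    · simpa using ih
    · simp

theorem reach_scan_sym {s : Sym} (hs : s ≠ .ind) (hs' : s ≠ .iota) (c : List Job)
    (v o : List Sym) :
    R 1 (scan :: c) (st (s :: v) [] [] o) (scan :: c) (st v [] [] o) := by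
  apply TaskMachine.Reach.step_le (n := 0)
  · cases s <;> first | contradiction | simpa using .refl 0 _ _
  · simp

theorem reach_drop (s : Sym) (c : List Job) (i m a o : List Sym) :
    R 1 (drop :: c) (st (s :: i) m a o) c (st i m a o) := by
  apply TaskMachine.Reach.step_le
  · simpa using .refl 0 _ _
  · simp

/-- The word for the axioms that fix the values of the given terms. -/
def defWord (l : List ALCOStar.Term) : List Sym := ALCOu.Ontology.enc (l.map defAxm)

@[simp] theorem defWord_nil : defWord [] = [] := rfl

@[simp] theorem defWord_cons (τ : ALCOStar.Term) (l : List ALCOStar.Term) :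
    defWord (τ :: l) = (defAxm τ).enc ++ defWord l := by
  simp [defWord, ALCOu.Ontology.enc]

@[simp] theorem defWord_append (l l' : List ALCOStar.Term) :
    defWord (l ++ l') = defWord l ++ defWord l' := by
  simp [defWord, ALCOu.Ontology.enc]

/-- The name is left on the input; `reach_scan_name` then passes over it without output, as it
contains no symbol that starts a term. -/
theorem reach_scan_ind (r : Name) (c : List Job) (v o : List Sym) :
    R (3 * (encName r).length + 10) (scan :: c) (st (.ind :: (encName r ++ v)) [] [] o) (scan :: c)
      (st (encName r ++ v) [] [] ((defAxm (.ind r)).enc.reverse ++ o)) := by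
  apply TaskMachine.Reach.step_le
  · have h := reach_codeTerm negative (.ind r)
      (emit .endName :: restore :: drop :: scan :: c) v [] []
    simp only [ALCOStar.Term.enc, List.cons_append] at h
    simpa [defAxm, ALCOu.Axm.enc, ALCOStar.Term.enc] using
      (h _).trans <|
      (reach_emits negative (restore :: drop :: scan :: c) _ _ [] _ [.endName]).trans <|
      (reach_restore negative (drop :: scan :: c) _ _ [] _).trans
      (by simpa using reach_drop negative .ind (scan :: c) (encName r ++ v) [] [] _)
  · simp; omega

/-- The description is read three times: to translate its body, to write the nominal of its name,
and to write the name as the subject of the assertion. The factor 9 is 4 for the translation, 1 for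
each of the two codings and 1 for each of the three restorations. -/
theorem reach_scan_iota (C : ALCOStar.Concept) (c : List Job) (v o : List Sym) :
    R (9 * C.enc.length + 40) (scan :: c) (st (.iota :: (C.enc ++ .close :: v)) [] [] o)
      (scan :: c)
      (st (C.enc ++ .close :: v) [] [] ((defAxm (.iota C)).enc.reverse ++ o)) := by
  apply TaskMachine.Reach.step_le
  · have hn := reach_nomTerm negative (.iota C)
      (restore :: emit .neg :: emit .atom :: emit .endName :: emit .close :: emit .ind ::
        codeTerm :: emit .endName :: restore :: drop :: scan :: c) v [] []
    have hc := reach_codeTerm negative (.iota C)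
      (emit .endName :: restore :: drop :: scan :: c) v [] []
    simp only [ALCOStar.Term.enc, List.cons_append, List.append_assoc, List.nil_append] at hn hc
    simpa [defAxm, ALCOu.Axm.enc, ALCOu.Concept.enc, ALCOu.Term.enc, ALCOStar.Term.enc] using
      (reach_skip negative _ _ _ _ _ _).trans <|
      (reach_conc negative C (restore :: emit .close :: emit .neg :: emit .conj :: nomTerm ::
        restore :: emit .neg :: emit .atom :: emit .endName :: emit .close :: emit .ind ::
        codeTerm :: emit .endName :: restore :: drop :: scan :: c) (.close :: v) _ _).trans <|
      (reach_restore negative _ _ _ _ _).trans <|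
      (reach_emits negative _ _ _ _ _ [.close, .neg, .conj]).trans <|
      .trans (by simpa using hn _) <|
      (reach_restore negative _ _ _ _ _).trans <|
      (reach_emits negative _ _ _ _ _ [.neg, .atom, .endName, .close, .ind]).trans <|
      .trans (by simpa using hc _) <|
      (reach_emits negative _ _ _ _ _ [.endName]).trans <|
      (reach_restore negative _ _ _ _ _).trans
      (by simpa [ALCOStar.Term.enc] using reach_drop negative .iota (scan :: c) (C.enc ++ .close :: v) [] [] _)
  · simp; omega

section

variable {N B : ℕ} (hB : 9 * N + 50 ≤ B)
include hB

mutual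
-- An amortized count: each symbol has a budget of `B` steps. Writing a defining axiom is charged to
-- the symbol that starts the term, and its cost is below `9 * N + 50` because the term has length
-- at most `N`. The words of nested descriptions may overlap, but their starting symbols differ.
theorem reach_scan_term : ∀ (τ : ALCOStar.Term) (_ : τ.enc.length ≤ N) (c : List Job)
    (v o : List Sym), R (B * τ.enc.length) (scan :: c) (st (τ.enc ++ v) [] [] o) (scan :: c)
      (st v [] [] ((defWord τ.terms).reverse ++ o))
  | .ind r, h, c, v, o => by
    refine TaskMachine.Reach.mono (by
      simpa [ALCOStar.Term.enc, ALCOStar.Term.terms] using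
        (reach_scan_ind negative r c v o).trans (reach_scan_name negative r c v _)) ?_
    have := Nat.mul_le_mul_right (encName r).length hB
    simp only [ALCOStar.Term.enc, List.length_cons, Nat.mul_add, Nat.add_mul] at *
    omega
  | .iota C, h, c, v, o => by
    simp only [ALCOStar.Term.enc, List.length_cons, List.length_append, List.length_nil] at h
    refine TaskMachine.Reach.mono (by
      simpa [ALCOStar.Term.enc, ALCOStar.Term.terms] using
        (reach_scan_iota negative C c v o).trans <|
        (reach_scan_conc C (by omega) c (.close :: v) _).trans
        (reach_scan_sym negative (s := .close) (by simp) (by simp) c v _)) ?_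
    simp only [ALCOStar.Term.enc, List.length_cons, List.length_append, List.length_nil,
      Nat.mul_add]
    omega
theorem reach_scan_conc : ∀ (C : ALCOStar.Concept) (_ : C.enc.length ≤ N) (c : List Job)
    (v o : List Sym), R (B * C.enc.length) (scan :: c) (st (C.enc ++ v) [] [] o) (scan :: c)
      (st v [] [] ((defWord C.terms).reverse ++ o))
  | .atom A, h, c, v, o => by
    refine TaskMachine.Reach.mono (by
      simpa [ALCOStar.Concept.enc, ALCOStar.Concept.terms] using
        (reach_scan_sym negative (s := .atom) (by simp) (by simp) c _ _).trans
          (reach_scan_name negative A c v o)) ?_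
    have := Nat.mul_le_mul_right (encName A).length hB
    simp only [ALCOStar.Concept.enc, List.length_cons, Nat.mul_add, Nat.add_mul] at *
    omega
  | .existing, h, c, v, o => by
    refine TaskMachine.Reach.mono (by
      simpa [ALCOStar.Concept.enc, ALCOStar.Concept.terms] using
        (reach_scan_sym negative (s := .existing) (by simp) (by simp) c v o)) ?_
    simp only [ALCOStar.Concept.enc, List.length_cons, List.length_nil]
    omega
  | .nom τ, h, c, v, o => by
    simp only [ALCOStar.Concept.enc, List.length_cons] at h
    refine TaskMachine.Reach.mono (by
      simpa [ALCOStar.Concept.enc, ALCOStar.Concept.terms] using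
        (reach_scan_sym negative (s := .nom) (by simp) (by simp) c _ _).trans
          (reach_scan_term τ (by omega) c v o)) ?_
    simp only [ALCOStar.Concept.enc, List.length_cons, Nat.mul_add]
    omega
  | .neg C, h, c, v, o => by
    simp only [ALCOStar.Concept.enc, List.length_cons] at h
    refine TaskMachine.Reach.mono (by
      simpa [ALCOStar.Concept.enc, ALCOStar.Concept.terms] using
        (reach_scan_sym negative (s := .neg) (by simp) (by simp) c _ _).trans
          (reach_scan_conc C (by omega) c v o)) ?_
    simp only [ALCOStar.Concept.enc, List.length_cons, Nat.mul_add]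
    omega
  | .conj C D, h, c, v, o => by
    simp only [ALCOStar.Concept.enc, List.length_cons, List.length_append] at h
    refine TaskMachine.Reach.mono (by
      simpa [ALCOStar.Concept.enc, ALCOStar.Concept.terms] using
        (reach_scan_sym negative (s := .conj) (by simp) (by simp) c _ _).trans <|
        (reach_scan_conc C (by omega) c (D.enc ++ v) o).trans
          (reach_scan_conc D (by omega) c v _)) ?_
    simp only [ALCOStar.Concept.enc, List.length_cons, List.length_append, Nat.mul_add]
    omega
  | .ex r C, h, c, v, o => by
    simp only [ALCOStar.Concept.enc, List.length_cons, List.length_append] at h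
    refine TaskMachine.Reach.mono (by
      simpa [ALCOStar.Concept.enc, ALCOStar.Concept.terms] using
        (reach_scan_sym negative (s := .ex) (by simp) (by simp) c _ _).trans <|
        (reach_scan_name negative r c (C.enc ++ v) o).trans
          (reach_scan_conc C (by omega) c v _)) ?_
    have := Nat.mul_le_mul_right (encName r).length hB
    simp only [ALCOStar.Concept.enc, List.length_cons, List.length_append, Nat.mul_add,
      Nat.add_mul] at *
    omega
end

end

end

section

variable (negative : Bool)

open Job

local notation "R" => TaskMachine.Reach (machine negative)

theorem reach_scan_axm {N B : ℕ} (hB : 9 * N + 50 ≤ B) (β : ALCOStar.Axm)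
    (h : β.enc.length ≤ N) (c : List Job) (v o : List Sym) :
    R (B * β.enc.length) (scan :: c) (st (β.enc ++ v) [] [] o) (scan :: c)
      (st v [] [] ((defWord β.terms).reverse ++ o)) := by
  cases β with
  | sub C D =>
    simp only [ALCOStar.Axm.enc, List.length_cons, List.length_append] at h
    refine TaskMachine.Reach.mono (by
      simpa [ALCOStar.Axm.enc, ALCOStar.Axm.terms] using
        (reach_scan_sym negative (s := .sub) (by simp) (by simp) c _ _).trans <|
        (reach_scan_conc negative hB C (by omega) c (.comma :: (D.enc ++ v)) o).trans <|
        (reach_scan_sym negative (s := .comma) (by simp) (by simp) c _ _).trans <|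
          reach_scan_conc negative hB D (by omega) c v _) ?_
    simp only [ALCOStar.Axm.enc, List.length_cons, List.length_append, Nat.mul_add]
    omega
  | inst C τ =>
    simp only [ALCOStar.Axm.enc, List.length_cons, List.length_append] at h
    refine TaskMachine.Reach.mono (by
      simpa [ALCOStar.Axm.enc, ALCOStar.Axm.terms] using
        (reach_scan_sym negative (s := .inst) (by simp) (by simp) c _ _).trans <|
        (reach_scan_conc negative hB C (by omega) c (τ.enc ++ v) o).trans <|
          reach_scan_term negative hB τ (by omega) c v _) ?_
    simp only [ALCOStar.Axm.enc, List.length_cons, List.length_append, Nat.mul_add]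
    omega
  | rel r τ₁ τ₂ =>
    simp only [ALCOStar.Axm.enc, List.length_cons, List.length_append] at h
    refine TaskMachine.Reach.mono (by
      simpa [ALCOStar.Axm.enc, ALCOStar.Axm.terms] using
        (reach_scan_sym negative (s := .rel) (by simp) (by simp) c _ _).trans <|
        (reach_scan_name negative r c (τ₁.enc ++ (τ₂.enc ++ v)) o).trans <|
        (reach_scan_term negative hB τ₁ (by omega) c _ _).trans <|
          reach_scan_term negative hB τ₂ (by omega) c v _) ?_
    have := Nat.mul_le_mul_right (encName r).length hB
    simp only [ALCOStar.Axm.enc, List.length_cons, List.length_append, Nat.mul_add,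
      Nat.add_mul] at *
    omega
  | eq τ₁ τ₂ =>
    simp only [ALCOStar.Axm.enc, List.length_cons, List.length_append] at h
    refine TaskMachine.Reach.mono (by
      simpa [ALCOStar.Axm.enc, ALCOStar.Axm.terms] using
        (reach_scan_sym negative (s := .eq) (by simp) (by simp) c _ _).trans <|
        (reach_scan_term negative hB τ₁ (by omega) c (τ₂.enc ++ v) _).trans <|
          reach_scan_term negative hB τ₂ (by omega) c v _) ?_
    simp only [ALCOStar.Axm.enc, List.length_cons, List.length_append, Nat.mul_add]
    omega

theorem reach_scan_form {N B : ℕ} (hB : 9 * N + 50 ≤ B) (φ : ALCOStar.Formula)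
    (h : φ.enc.length ≤ N) (c : List Job) (v o : List Sym) :
    R (B * φ.enc.length) (scan :: c) (st (φ.enc ++ v) [] [] o) (scan :: c)
      (st v [] [] ((defWord φ.terms).reverse ++ o)) := by
  induction φ generalizing v o with
  | ax β => exact reach_scan_axm negative hB β h c v o
  | neg φ ih =>
    simp only [ALCOStar.Formula.enc, List.length_cons] at h
    refine TaskMachine.Reach.mono (by
      simpa [ALCOStar.Formula.enc, ALCOStar.Formula.terms] using
        (reach_scan_sym negative (s := .fneg) (by simp) (by simp) c _ _).trans <|
          ih (by omega) v o) ?_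
    simp only [ALCOStar.Formula.enc, List.length_cons, Nat.mul_add]
    omega
  | and φ ψ ih ih' =>
    simp only [ALCOStar.Formula.enc, List.length_cons, List.length_append] at h
    refine TaskMachine.Reach.mono (by
      simpa [ALCOStar.Formula.enc, ALCOStar.Formula.terms] using
        (reach_scan_sym negative (s := .fand) (by simp) (by simp) c _ _).trans <|
        (ih (by omega) (ψ.enc ++ v) o).trans <| ih' (by omega) v _) ?_
    simp only [ALCOStar.Formula.enc, List.length_cons, List.length_append, Nat.mul_add]
    omega

theorem reach_scan_end (c : List Job) (m a o : List Sym) :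
    R 1 (scan :: c) (st [] m a o) c (st [] m a o) := by
  apply TaskMachine.Reach.step_le
  · simpa using .refl 0 _ _
  · simp

/-- Before its output is reversed, the machine takes at most quadratically many steps. -/
theorem reach_reversed_output (φ : ALCOStar.Formula) :
    R ((9 * φ.enc.length + 60) * φ.enc.length + 4) [start] (st φ.enc [] [] []) [rev]
      (st [] [] [] (reduction negative φ).enc.reverse) := by
  apply TaskMachine.Reach.step_le
  · have hr : (reduction negative φ).enc =
        [.sub, .neg, .conj, .atom, .endName, .neg, .atom, .endName, .comma, .conj, .exU, .neg,
          .atom, .endName] ++ ((trFormula negative φ).enc ++ defWord φ.terms) := by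
      simp [reduction, ALCOu.Ontology.enc, ALCOu.Axm.enc, ALCOu.Concept.enc, defWord]
    rw [hr]
    have h1 := reach_form negative φ [restore, scan, rev] [] []
    have h2 := reach_scan_form negative (B := 9 * φ.enc.length + 50) le_rfl φ le_rfl [rev] []
    simp only [List.append_nil] at h1 h2
    simpa using
      (h1 _).trans <|
      (reach_restore negative [scan, rev] _ _ [] _).trans <|
      .trans (by simpa using h2 _) <|
      reach_scan_end negative [rev] _ _ _
  · simp only [Nat.add_mul]
    omega

-- Output length and total running time.

theorem length_pushes {D S : Type} [DecidableEq D] (l : List (D × S)) (f : D → List S) (d : D) :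
    (TaskMachine.pushes l f d).length ≤ (f d).length + l.length := by
  induction l generalizing f with
  | nil => simp [TaskMachine.pushes]
  | cons p l ih =>
    refine (ih (Function.update f p.1 (p.2 :: f p.1))).trans ?_
    by_cases h : d = p.1
    · subst h; simp only [Function.update_self, List.length_cons]; omega
    · simp only [Function.update_of_ne h, List.length_cons]; omega

/-- Bounds the length of the output by the running time, so that the word of the ontology need not
be measured directly. -/
theorem TaskMachine.Reach.length_le {D T S : Type} [DecidableEq D] {M : TaskMachine D T S}
    {K : ℕ} (hK : ∀ t s, (M.act t s).1.length ≤ K) {n : ℕ} {c c' : List T} {f f' : D → List S}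
    (h : M.Reach n c f c' f') (d : D) : (f' d).length ≤ (f d).length + K * n := by
  induction h with
  | refl n c f => exact Nat.le_add_right _ _
  | @step n t c c' f f' h ih =>
    have h1 := length_pushes (M.act t (popSym f (M.src t))).1 (popStk f (M.src t)) d
    have h2 : (popStk f (M.src t) d).length ≤ (f d).length := by
      cases M.src t with
      | none => exact le_rfl
      | some e =>
        by_cases he : d = e
        · subst he; simp
        · simp [he]
    have h3 := hK t (popSym f (M.src t))
    rw [Nat.mul_add]
    omega

theorem length_act_le (t : Job) (s : Option Sym) : (taskAct negative t s).1.length ≤ 14 := by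
  cases negative <;> revert t s <;> decide

theorem reach_output (φ : ALCOStar.Formula) :
    R (15 * ((9 * φ.enc.length + 60) * φ.enc.length + 4) + 1) [start] (st φ.enc [] [] []) []
      (st [] [] (reduction negative φ).enc []) := by
  have h := reach_reversed_output negative φ
  -- With `n` steps so far, the output has at most `14 * n` symbols, and reversing it takes one step
  -- more than its length: `15 * n + 1` in all.
  have hl := h.length_le (length_act_le negative) .out
  have h' := h.trans (reach_rev negative [] [] [] [] _)
  simp only [List.reverse_reverse, List.append_nil] at h'
  refine h'.mono ?_
  simp only [st, List.length_nil] at hl ⊢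
  omega

theorem reduction_computable :
    Nonempty (Turing.TM2ComputableInPolyTime ALCOStar.Formula.enc ALCOu.Ontology.enc
      (reduction negative)) := by
  refine (machine negative).computableInPolyTime _ _ _
    (15 * ((9 * Polynomial.X + 60) * Polynomial.X + 4) + 1) fun φ => ?_
  have hst : ∀ w, Function.update (fun _ => []) Stk.inp w = st w [] [] [] := fun w => by
    funext k; cases k <;> rfl
  have hst' : ∀ w, Function.update (fun _ => []) Stk.aux w = st [] [] w [] := fun w => by
    funext k; cases k <;> rfl
  have h := reach_output negative φ
  rw [← hst, ← hst'] at h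
  exact h.mono (by simp)

end

/-- Satisfiability under the semantics given by the flag is reducible in polynomial time. -/
theorem polyTimeReducible (negative : Bool) :
    PolyTimeReducible ALCOStar.Formula.enc ALCOu.Ontology.enc
      (fun φ => ∃ I, SatFormula negative I φ) ALCOu.Ontology.Satisfiable :=
  ⟨reduction negative, reduction_computable negative, exists_satFormula_iff negative⟩

end FreeDL

theorem mainTheorem7 :
    FreeDL.PolyTimeReducible FreeDL.ALCOStar.Formula.enc FreeDL.ALCOu.Ontology.enc
        FreeDL.ALCOStar.Formula.SatisfiablePos FreeDL.ALCOu.Ontology.Satisfiable ∧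
      FreeDL.PolyTimeReducible FreeDL.ALCOStar.Formula.enc FreeDL.ALCOu.Ontology.enc
        FreeDL.ALCOStar.Formula.SatisfiableNeg FreeDL.ALCOu.Ontology.Satisfiable :=
  ⟨FreeDL.polyTimeReducible false, FreeDL.polyTimeReducible true⟩
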